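/- Let $F=\mathbb R$ or $F=\mathbb C$, let $n\ge 0$ be an integer, $V=F^n$ (column vectors), $V^*$ its dual (row vectors), let $\mathfrak{sl}(V)$ be the space of $n\times n$ matrices over $F$ with zero trace, and put $$X:=\mathfrak{sl}(V)\times V\times V^*.$$ Let $G=\mathrm{GL}(V)=\mathrm{GL}_n(F)$ and $\widetilde G=G\rtimes\{1,\sigma\}$, where the two-element group $\{1,\sigma\}$ acts on $G$ by $\sigma: g\mapsto (g^{t})^{-1}$. The group $\widetilde G$ acts on $X$ by $$g(A,v,\phi)=(gAg^{-1},\,gv,\,\phi g^{-1})\quad (g\in G),\qquad \sigma(A,v,\phi)=(A^t,\phi^t,v^t).$$ Let $\chi$ be the character of $\widetilde G$ which equals $1$ on $G$ and $-1$ on $\widetilde G\setminus G$. Let $C:=(V\times 0)\cup(0\times V^*)\subset V\times V^*$. Let $\mathcal S(X)$ be the space of complex-valued Schwartz functions on the real vector space $X$, and $\mathcal S^*(X)$ its continuous dual, the space of Schwartz (tempered) distributions. Let $\mathcal F_{V\times V^*}:\mathcal S^*(X)\to\mathcal S^*(X)$ be the partial Fourier transform in the variable of $V\times V^*$, given by $(\mathcal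 F_{V\times V^*}\xi)(f)=\xi(\mathcal F_{V\times V^*}f)$ with $$(\mathcal F_{V\times V^*}f)(A,y)=\int_{V\times V^*}e^{2\pi i\,\mathrm{Re}\,B(w,y)}f(A,w)\,dw,\qquad B((v,\phi),(v',\phi'))=\phi(v')+\phi'(v),$$ where $dw$ is Lebesgue measure, which is the self-dual Haar measure. Let $\xi\in\mathcal S^*(X)$ be $(\widetilde G,\chi)$-equivariant, that is, $\xi(f\circ g)=\chi(g)\,\xi(f)$ for all $g\in\widetilde G$ and $f\in\mathcal S(X)$. Suppose that $$\mathrm{Supp}(\xi)\subset \mathfrak{sl}(V)\times C\qquad\text{and}\qquad \mathrm{Supp}(\mathcal F_{V\times V^*}\xi)\subset \mathfrak{sl}(V)\times C.$$ Then $\xi=0$. -/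

import Mathlib

open scoped SchwartzMap ContDiff FourierTransform
open MeasureTheory

set_option linter.unusedSectionVars false

noncomputable section

namespace PartialFT

universe u w

variable {E : Type u} {W : Type u} {H : Type w}
  [NormedAddCommGroup E] [NormedSpace ℝ E]
  [NormedAddCommGroup W] [NormedSpace ℝ W] [FiniteDimensional ℝ W]
  [MeasurableSpace W] [BorelSpace W]
  [NormedAddCommGroup H] [NormedSpace ℂ H]
  (μ : Measure W) [μ.IsAddHaarMeasure] (L : W →L[ℝ] W →L[ℝ] ℝ)

/-- The partial Fourier integral in the second variable. -/
def pft (f : E × W → H) (p : E × W) : H :=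
  VectorFourier.fourierIntegral 𝐞 μ L.toLinearMap₁₂ (fun v => f (p.1, v)) p.2

theorem hasTemperateGrowth_slice (a : E) :
    (fun w : W => (a, w)).HasTemperateGrowth := by
  have : (fun w : W => (a, w)) = fun w => (ContinuousLinearMap.inr ℝ E W) w + (a, 0) := by
    ext w <;> simp
  rw [this]
  exact (ContinuousLinearMap.hasTemperateGrowth _).add (.const _)

/-- The restriction of a Schwartz function to the slice over `a`. -/
def slice (a : E) (f : 𝓢(E × W, H)) : 𝓢(W, H) :=
  SchwartzMap.compCLMOfAntilipschitz ℂ (K := 1) (hasTemperateGrowth_slice a)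
    (AntilipschitzWith.of_le_mul_dist fun x y => by simp [Prod.dist_eq]) f

@[simp] theorem slice_apply (a : E) (f : 𝓢(E × W, H)) (v : W) : slice a f v = f (a, v) := rfl

theorem norm_iteratedFDeriv_slice_le (a : E) (f : 𝓢(E × W, H)) (j : ℕ) (v : W) :
    ‖iteratedFDeriv ℝ j (slice a f) v‖ ≤ ‖iteratedFDeriv ℝ j f (a, v)‖ := by
  have h1 : (slice a f : W → H) =
      (fun p => f (p + (a, 0))) ∘ (ContinuousLinearMap.inr ℝ E W) := by
    ext w; simp
  have hs : ContDiff ℝ j (fun p : E × W => f (p + (a, 0))) :=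
    (f.smooth j).comp (contDiff_id.add contDiff_const)
  rw [h1, ContinuousLinearMap.iteratedFDeriv_comp_right _ hs v le_rfl]
  refine (ContinuousMultilinearMap.norm_compContinuousLinearMap_le _ _).trans ?_
  rw [iteratedFDeriv_comp_add_right]
  have h2 : ‖ContinuousLinearMap.inr ℝ E W‖ ≤ 1 :=
    ContinuousLinearMap.opNorm_le_bound _ zero_le_one fun x => by simp [Prod.norm_def]
  have h3 : ((ContinuousLinearMap.inr ℝ E W) v + (a, 0) : E × W) = (a, v) := by ext <;> simp
  rw [h3]
  calc _ ≤ ‖iteratedFDeriv ℝ j f (a, v)‖ * ∏ _i : Fin j, (1 : ℝ) := by gcongr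
    _ = _ := by simp

/-- The sup of Schwartz seminorms controlling weights up to `k` and derivatives up to `j`. -/
def bigSem (k j : ℕ) : Seminorm ℂ 𝓢(E × W, H) :=
  (2 ^ k : NNReal) • (Finset.Iic (k, j)).sup (schwartzSeminormFamily ℂ (E × W) H)

theorem continuous_bigSem (k j : ℕ) : Continuous (bigSem (E := E) (W := W) (H := H) k j) := by
  have h := schwartz_withSeminorms ℂ (E × W) H
  exact (Seminorm.continuous_finsetSup fun i _ => h.continuous_seminorm i).const_smul (2 ^ k : NNReal)

theorem weight_le (k N j : ℕ) (f : 𝓢(E × W, H)) (a : E) (v : W) :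
    ‖a‖ ^ k * ‖iteratedFDeriv ℝ j f (a, v)‖ ≤ bigSem (k + N) j f * (1 + ‖v‖) ^ (-(N : ℝ)) := by
  have hv : 0 < 1 + ‖v‖ := by positivity
  have h := SchwartzMap.one_add_le_sup_seminorm_apply (𝕜 := ℂ) (m := (k + N, j)) (k := k + N)
    (n := j) le_rfl le_rfl f (a, v)
  rw [Real.rpow_neg hv.le, Real.rpow_natCast, ← div_eq_mul_inv, le_div_iff₀ (by positivity)]
  calc _ = (‖a‖ ^ k * (1 + ‖v‖) ^ N) * ‖iteratedFDeriv ℝ j f (a, v)‖ := by ring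
    _ ≤ ((1 + ‖(a, v)‖) ^ k * (1 + ‖(a, v)‖) ^ N) * ‖iteratedFDeriv ℝ j f (a, v)‖ := by
      have h1 : ‖a‖ ≤ 1 + ‖(a, v)‖ := (norm_fst_le (a, v)).trans (by linarith)
      have h2 : ‖v‖ ≤ ‖(a, v)‖ := norm_snd_le (a, v)
      gcongr
    _ ≤ _ := by
      rw [← pow_add]
      exact h

theorem pft_def (f : E × W → H) (p : E × W) :
    pft μ L f p = ∫ v, (𝐞 (-L v p.2) : ℂ) • f (p.1, v) ∂μ := rfl

theorem integrable_slice (f : 𝓢(E × W, H)) (p : E × W) :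
    Integrable (fun v => (𝐞 (-L v p.2) : ℂ) • f (p.1, v)) μ := by
  have h := ((slice p.1 f).integrable (μ := μ))
  refine h.norm.mono' ?_ ?_
  · refine Continuous.aestronglyMeasurable ?_
    have : Continuous fun v => L v p.2 := by fun_prop
    have h2 : Continuous fun v => (𝐞 (-L v p.2) : ℂ) := by fun_prop
    exact h2.smul (slice p.1 f).continuous
  · filter_upwards with v
    simp [norm_smul, Circle.norm_coe]

/-- Composition on the right with a real operator, as a complex linear map. -/
def precompC (X : Type*) [NormedAddCommGroup X] [NormedSpace ℝ X] (P : X →L[ℝ] X) :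
    (X →L[ℝ] H) →L[ℂ] (X →L[ℝ] H) :=
  LinearMap.mkContinuous
    { toFun := fun A => A.comp P
      map_add' := fun _ _ => rfl
      map_smul' := fun _ _ => rfl } ‖P‖ fun A => by
        rw [mul_comm]; exact A.opNorm_comp_le P

/-- The integrand of the derivative of the partial Fourier integral. -/
def dpft : 𝓢(E × W, H) →L[ℂ] 𝓢(E × W, E × W →L[ℝ] H) :=
  SchwartzMap.postcompCLM (precompC (H := H) (E × W)
      ((ContinuousLinearMap.inl ℝ E W).comp (ContinuousLinearMap.fst ℝ E W))) ∘L
    SchwartzMap.fderivCLM ℂ (E × W) H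
  + (-2 * Real.pi * Complex.I) • SchwartzMap.smulRightCLM ℂ H
      (L.bilinearComp (ContinuousLinearMap.snd ℝ E W) (ContinuousLinearMap.snd ℝ E W))

theorem dpft_apply (f : 𝓢(E × W, H)) (p q : E × W) :
    dpft L f p q = fderiv ℝ f p (q.1, 0) + (-2 * Real.pi * Complex.I) • L p.2 q.2 • f p := by
  rfl

theorem hasFDerivAt_integrand (f : 𝓢(E × W, H)) (v : W) (q : E × W) :
    HasFDerivAt (fun q : E × W => (𝐞 (-L v q.2) : ℂ) • f (q.1, v))
      ((𝐞 (-L v q.2) : ℂ) • dpft L f (q.1, v)) q := by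
  have h1 : HasFDerivAt (fun q : E × W => (𝐞 (-L v q.2) : ℂ))
      (((-2 * Real.pi * Complex.I * 𝐞 (-L v q.2)) •
        (Complex.ofRealCLM ∘L (L v))).comp (ContinuousLinearMap.snd ℝ E W)) q :=
    (Real.hasFDerivAt_fourierChar_neg_bilinear_right L v q.2).comp q hasFDerivAt_snd
  have h0 : HasFDerivAt (fun q : E × W => (q.1, v))
      ((ContinuousLinearMap.inl ℝ E W).comp (ContinuousLinearMap.fst ℝ E W)) q := by
    refine ((hasFDerivAt_fst (𝕜 := ℝ) (p := q)).prodMk (hasFDerivAt_const v q)).congr_fderiv ?_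
    ext <;> simp
  have h2 : HasFDerivAt (fun q : E × W => f (q.1, v))
      ((fderiv ℝ f (q.1, v)).comp
        ((ContinuousLinearMap.inl ℝ E W).comp (ContinuousLinearMap.fst ℝ E W))) q :=
    HasFDerivAt.comp q (f := fun q : E × W => (q.1, v)) (f.differentiableAt.hasFDerivAt) h0
  refine (h1.smul h2).congr_fderiv (ContinuousLinearMap.ext fun r => ?_)
  have e : ((𝐞 (-L v q.2) : ℂ) • dpft L f (q.1, v)) r =
      (𝐞 (-L v q.2) : ℂ) • (fderiv ℝ f (q.1, v) (r.1, 0) +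
        (-2 * Real.pi * Complex.I) • L v r.2 • f (q.1, v)) := rfl
  rw [e]
  set z : ℂ := (𝐞 (-L v q.2) : ℂ)
  simp only [add_apply, smul_apply,
    ContinuousLinearMap.comp_apply, ContinuousLinearMap.smulRight_apply,
    ContinuousLinearMap.coe_fst', ContinuousLinearMap.coe_snd', ContinuousLinearMap.inl_apply,
    Complex.ofRealCLM_apply, smul_add, smul_eq_mul]
  congr 1
  rw [← Complex.coe_smul (L v r.2), smul_smul, smul_smul]
  congr 1
  ring

theorem hasFDerivAt_pft (f : 𝓢(E × W, H)) (p : E × W) :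
    HasFDerivAt (pft μ L f) (pft μ L (dpft L f) p) p := by
  have hN := Measure.integrable_pow_neg_integrablePower μ
  set N := μ.integrablePower
  have := hasFDerivAt_integral_of_dominated_of_fderiv_le (𝕜 := ℝ) (s := Set.univ) (μ := μ)
    (x₀ := p)
    (F := fun (p : E × W) (v : W) => (𝐞 (-L v p.2) : ℂ) • f (p.1, v))
    (F' := fun (p : E × W) (v : W) => (𝐞 (-L v p.2) : ℂ) • dpft L f (p.1, v))
    (bound := fun v => bigSem (0 + N) 0 (dpft L f) * (1 + ‖v‖) ^ (-(N : ℝ)))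
    Filter.univ_mem (.of_forall fun q => (integrable_slice μ L f q).aestronglyMeasurable)
    (integrable_slice μ L f p) (integrable_slice μ L (dpft L f) p).aestronglyMeasurable
    (.of_forall fun v q _ => ?_) (hN.const_mul _)
    (.of_forall fun v q _ => hasFDerivAt_integrand L f v q)
  · exact this
  · have := weight_le 0 N 0 (dpft L f) q.1 v
    rw [norm_smul, Circle.norm_coe, one_mul]
    rwa [pow_zero, one_mul, norm_iteratedFDeriv_zero] at this

theorem contDiff_pft_aux (m : ℕ) : ∀ {H : Type u} [NormedAddCommGroup H] [NormedSpace ℂ H]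
    (f : 𝓢(E × W, H)), ContDiff ℝ m (pft μ L f) := by
  induction m with
  | zero =>
    intro H _ _ f
    rw [Nat.cast_zero, contDiff_zero]
    exact continuous_iff_continuousAt.2 fun p => (hasFDerivAt_pft μ L f p).continuousAt
  | succ m ih =>
    intro H _ _ f
    rw [Nat.cast_succ, contDiff_succ_iff_hasFDerivAt]
    exact ⟨_, ih (dpft L f), hasFDerivAt_pft μ L f⟩

theorem fderiv_pft (f : 𝓢(E × W, H)) : fderiv ℝ (pft μ L f) = pft μ L (dpft L f) :=
  funext fun p => (hasFDerivAt_pft μ L f p).fderiv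

theorem contDiff_pft {E W : Type u} 
  [NormedAddCommGroup E] [NormedSpace ℝ E]
  [NormedAddCommGroup W] [NormedSpace ℝ W] [FiniteDimensional ℝ W]
  [MeasurableSpace W] [BorelSpace W]
  (μ : Measure W) [μ.IsAddHaarMeasure] (L : W →L[ℝ] W →L[ℝ] ℝ)
    (f : 𝓢(E × W, ℂ)) : ContDiff ℝ ∞ (pft μ L f) := by
  rw [contDiff_infty_iff_fderiv, fderiv_pft]
  refine ⟨fun p => (hasFDerivAt_pft μ L f p).differentiableAt, ?_⟩
  exact contDiff_infty.2 fun n => contDiff_pft_aux μ L n _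

theorem bound_zero (hL : ∀ w, ∃ v, ‖v‖ ≤ 1 ∧ ‖w‖ ≤ |L v w|) (k : ℕ) :
    ∃ q : Seminorm ℂ 𝓢(E × W, H), Continuous q ∧
      ∀ (f : 𝓢(E × W, H)) (p : E × W), ‖p‖ ^ k * ‖pft μ L f p‖ ≤ q f := by
  have hN := Measure.integrable_pow_neg_integrablePower μ
  set N := μ.integrablePower
  set J := ∫ v, (1 + ‖v‖) ^ (-(N : ℝ)) ∂μ
  have hJ : 0 ≤ J := integral_nonneg fun v => by positivity
  set q1 : Seminorm ℂ 𝓢(E × W, H) := J.toNNReal • bigSem (k + N) 0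
  set q2 : Seminorm ℂ 𝓢(E × W, H) :=
    (2 ^ k : NNReal) • ∑ j ∈ Finset.range (k + 1), J.toNNReal • bigSem (0 + N) j
  have key : ∀ (l j : ℕ) (f : 𝓢(E × W, H)) (a : E),
      ∫ v, ‖a‖ ^ l * ‖iteratedFDeriv ℝ j f (a, v)‖ ∂μ ≤ J * bigSem (l + N) j f := by
    intro l j f a
    rw [mul_comm, ← integral_const_mul]
    refine integral_mono_of_nonneg (.of_forall fun v => by positivity) (hN.const_mul _)
      (.of_forall fun v => weight_le l N j f a v)
  have e1 : ∀ (f : 𝓢(E × W, H)) (p : E × W), ‖p.1‖ ^ k * ‖pft μ L f p‖ ≤ q1 f := by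
    intro f p
    have := key k 0 f p.1
    simp only [norm_iteratedFDeriv_zero] at this
    rw [integral_const_mul] at this
    have h2 : q1 f = J * bigSem (k + N) 0 f := by
      simp [q1, NNReal.smul_def, Real.coe_toNNReal _ hJ]
    rw [h2]
    refine le_trans ?_ this
    gcongr
    exact VectorFourier.norm_fourierIntegral_le_integral_norm _ _ _ _ _
  have e2 : ∀ (f : 𝓢(E × W, H)) (p : E × W), ‖p.2‖ ^ k * ‖pft μ L f p‖ ≤ q2 f := by
    intro f p
    obtain ⟨v, hv1, hv2⟩ := hL p.2
    have h := VectorFourier.pow_mul_norm_iteratedFDeriv_fourierIntegral_le (μ := μ) L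
      (f := slice p.1 f) (K := 0) (N := k) ((slice p.1 f).smooth k)
      (fun i j _ _ => (slice p.1 f).integrable_pow_mul_iteratedFDeriv μ i j)
      (k := 0) (n := k) (by simp) le_rfl v p.2
    simp only [norm_iteratedFDeriv_zero] at h
    calc ‖p.2‖ ^ k * ‖pft μ L f p‖ ≤ |L v p.2| ^ k * ‖pft μ L f p‖ := by gcongr
      _ ≤ _ := h
      _ ≤ 1 ^ k * (2 * Real.pi * ‖L‖) ^ 0 * (2 * (0 : ℕ) + 2) ^ k *
          ∑ j ∈ Finset.range (k + 1), J * bigSem (0 + N) j f := by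
        rw [zero_add, Finset.range_one, Finset.singleton_product, Finset.sum_map]
        gcongr with j hj
        simp only [Function.Embedding.coeFn_mk, pow_zero, one_mul]
        have := key 0 j f p.1
        simp only [pow_zero, one_mul] at this
        refine le_trans ?_ this
        refine integral_mono_of_nonneg (.of_forall fun v => by positivity) ?_
          (.of_forall fun v => norm_iteratedFDeriv_slice_le p.1 f j v)
        refine (hN.const_mul (bigSem (0 + N) j f)).mono' ?_ (.of_forall fun v => ?_)
        · refine Continuous.aestronglyMeasurable ?_
          have := (f.smooth j).continuous_iteratedFDeriv (m := j) le_rfl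
          fun_prop
        · simpa using weight_le 0 N j f p.1 v
      _ = q2 f := by
        simp [q2, NNReal.smul_def, Real.coe_toNNReal _ hJ]
        
  refine ⟨q1 + q2, ?_, fun f p => ?_⟩
  · have c1 : Continuous q1 := (continuous_bigSem (k + N) 0).const_smul J.toNNReal
    have c2 : Continuous q2 := by
      exact (Seminorm.continuous_finsetSum fun j _ =>
        (continuous_bigSem (0 + N) j).const_smul J.toNNReal).const_smul (2 ^ k : NNReal)
    exact c1.add c2
  · refine le_trans ?_ (add_le_add (e1 f p) (e2 f p))
    rw [← add_mul]
    gcongr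
    rcases le_total ‖p.1‖ ‖p.2‖ with h | h
    · rw [Prod.norm_def, max_eq_right h]; simp
    · rw [Prod.norm_def, max_eq_left h]; simp

theorem bound_step (k m : ℕ)
    (h : ∃ q : Seminorm ℂ 𝓢(E × W, E × W →L[ℝ] H), Continuous q ∧
      ∀ (f : 𝓢(E × W, E × W →L[ℝ] H)) (p : E × W), ‖p‖ ^ k * ‖iteratedFDeriv ℝ m (pft μ L f) p‖ ≤ q f) :
    ∃ q : Seminorm ℂ 𝓢(E × W, H), Continuous q ∧
      ∀ (f : 𝓢(E × W, H)) (p : E × W), ‖p‖ ^ k * ‖iteratedFDeriv ℝ (m + 1) (pft μ L f) p‖ ≤ q f := by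
  obtain ⟨q, hq, hb⟩ := h
  refine ⟨q.comp (dpft L).toLinearMap, hq.comp (dpft L).continuous, fun f p => ?_⟩
  rw [← norm_iteratedFDeriv_fderiv, fderiv_pft]
  exact hb (dpft L f) p

theorem bound_aux (hL : ∀ w, ∃ v, ‖v‖ ≤ 1 ∧ ‖w‖ ≤ |L v w|) (k m : ℕ) :
    ∀ (H : Type u) [NormedAddCommGroup H] [NormedSpace ℂ H],
    ∃ q : Seminorm ℂ 𝓢(E × W, H), Continuous q ∧
      ∀ (f : 𝓢(E × W, H)) (p : E × W), ‖p‖ ^ k * ‖iteratedFDeriv ℝ m (pft μ L f) p‖ ≤ q f := by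
  induction m with
  | zero => intro H _ _; simpa using bound_zero μ L hL k
  | succ m ih => intro H _ _; exact bound_step μ L k m (ih _)

theorem bound (hL : ∀ w, ∃ v, ‖v‖ ≤ 1 ∧ ‖w‖ ≤ |L v w|) (k m : ℕ) :
    ∃ q : Seminorm ℂ 𝓢(E × W, ℂ), Continuous q ∧
      ∀ (f : 𝓢(E × W, ℂ)) (p : E × W), ‖p‖ ^ k * ‖iteratedFDeriv ℝ m (pft μ L f) p‖ ≤ q f := by
  cases m with
  | zero => simpa using bound_zero μ L hL k
  | succ m => exact bound_step μ L k m (bound_aux μ L hL k m _)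

theorem bound_schwartz (hL : ∀ w, ∃ v, ‖v‖ ≤ 1 ∧ ‖w‖ ≤ |L v w|) (n : ℕ × ℕ) :
    ∃ (s : Finset (ℕ × ℕ)) (C : ℝ), 0 ≤ C ∧ ∀ (f : 𝓢(E × W, ℂ)) (x : E × W),
      ‖x‖ ^ n.1 * ‖iteratedFDeriv ℝ n.2 (pft μ L f) x‖ ≤
        C * s.sup (schwartzSeminormFamily ℂ (E × W) ℂ) f := by
  obtain ⟨q, hq, hb⟩ := bound (E := E) μ L hL n.1 n.2
  obtain ⟨s, C, -, h⟩ := Seminorm.bound_of_continuous (schwartz_withSeminorms ℂ (E × W) ℂ) q hq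
  exact ⟨s, C, C.2, fun f x => (hb f x).trans (h f)⟩

theorem pft_add (f g : 𝓢(E × W, H)) (p : E × W) :
    pft μ L (f + g : 𝓢(E × W, H)) p = pft μ L f p + pft μ L g p := by
  simp only [pft_def, add_apply, smul_add]
  exact integral_add (integrable_slice μ L f p) (integrable_slice μ L g p)

theorem pft_smul (c : ℂ) (f : 𝓢(E × W, H)) (p : E × W) :
    pft μ L (c • f : 𝓢(E × W, H)) p = c • pft μ L f p := by
  simp only [pft_def, smul_apply, smul_comm _ c]
  exact integral_smul _ _

end PartialFT

open scoped Matrix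

section Space

/-- The space `sl(V)`, `V = F ^ n`, of operators (matrices) with zero trace. -/
def Sl (n : ℕ) (F : Type*) [RCLike F] : Type _ :=
  LinearMap.ker (Matrix.traceLinearMap (Fin n) F F)

attribute [local instance] Matrix.normedAddCommGroup Matrix.normedSpace

/-- `sl(V)` carries the sup norm of the entries; Schwartz functions, Schwartz distributions
and supports do not depend on the choice of a norm. -/
instance Sl.instNormedAddCommGroup (n : ℕ) (F : Type*) [RCLike F] : NormedAddCommGroup (Sl n F) :=
  Submodule.normedAddCommGroup (LinearMap.ker (Matrix.traceLinearMap (Fin n) F F))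

instance Sl.instNormedSpaceBase (n : ℕ) (F : Type*) [RCLike F] : NormedSpace F (Sl n F) :=
  Submodule.normedSpace (LinearMap.ker (Matrix.traceLinearMap (Fin n) F F))

instance Sl.instNormedSpaceReal (n : ℕ) (F : Type*) [RCLike F] : NormedSpace ℝ (Sl n F) :=
  Submodule.normedSpace (LinearMap.ker (Matrix.traceLinearMap (Fin n) F F))

instance Sl.instIsScalarTower (n : ℕ) (F : Type*) [RCLike F] : IsScalarTower ℝ F (Sl n F) :=
  inferInstanceAs (IsScalarTower ℝ F (LinearMap.ker (Matrix.traceLinearMap (Fin n) F F)))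

instance Sl.instFiniteDimensional (n : ℕ) (F : Type*) [RCLike F] : FiniteDimensional ℝ (Sl n F) :=
  haveI : FiniteDimensional F (Sl n F) :=
    inferInstanceAs (FiniteDimensional F (LinearMap.ker (Matrix.traceLinearMap (Fin n) F F)))
  Module.Finite.trans F _

end Space

/-- The space `V × V*`, `V = F ^ n`: vectors of `V` are column vectors, elements of the dual
space `V*` are row vectors, and the evaluation `φ(v)` is `φ ⬝ᵥ v`. -/
abbrev VVdual (n : ℕ) (F : Type*) : Type _ := (Fin n → F) × (Fin n → F)

/-- The space `X = sl(V) × V × V*`. -/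
abbrev XSpace (n : ℕ) (F : Type*) [RCLike F] : Type _ := Sl n F × VVdual n F


/-! ### The groups `G = GL(V)` and `G ⋊ {1, σ}`, and their action on `X` -/

/-- The involution `g ↦ (gᵗ)⁻¹` of `GL_n(F)`. -/
def transposeInv (n : ℕ) (F : Type*) [RCLike F] : MulAut (GL (Fin n) F) where
  toFun g := ⟨(g⁻¹).valᵀ, g.valᵀ,
    by rw [← Matrix.transpose_mul, Units.mul_inv, Matrix.transpose_one],
    by rw [← Matrix.transpose_mul, Units.inv_mul, Matrix.transpose_one]⟩
  invFun g := ⟨(g⁻¹).valᵀ, g.valᵀ,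
    by rw [← Matrix.transpose_mul, Units.mul_inv, Matrix.transpose_one],
    by rw [← Matrix.transpose_mul, Units.inv_mul, Matrix.transpose_one]⟩
  left_inv g := Units.ext (Matrix.transpose_transpose _)
  right_inv g := Units.ext (Matrix.transpose_transpose _)
  map_mul' g h := Units.ext (by simp [_root_.mul_inv_rev])

/-- The homomorphism from the two-element group `ℤˣ = {1, -1}` sending `-1` to an
element `a` with `a * a = 1`. -/
def involutionHom {K : Type*} [Group K] (a : K) (ha : a * a = 1) : ℤˣ →* K where
  toFun s := if s = 1 then 1 else a
  map_one' := if_pos rfl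
  map_mul' s t := by
    rcases Int.units_eq_one_or s with rfl | rfl <;> rcases Int.units_eq_one_or t with rfl | rfl <;>
      simp [ha]

theorem involutionHom_neg_one {K : Type*} [Group K] (a : K) (ha : a * a = 1) :
    involutionHom a ha (-1) = a := by
  have h : (-1 : ℤˣ) ≠ 1 := by decide
  simp [involutionHom, h]

/-- The action of the two-element group `{1, σ} = {1, -1} = ℤˣ` on `GL_n(F)` by
`g ↦ (gᵗ)⁻¹`. -/
def sigmaAut (n : ℕ) (F : Type*) [RCLike F] : ℤˣ →* MulAut (GL (Fin n) F) :=
  involutionHom (transposeInv n F) (MulEquiv.ext fun _ => Units.ext (Matrix.transpose_transpose _))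

/-- The group `GL(V) ⋊ {1, σ}`. -/
abbrev GTilde (n : ℕ) (F : Type*) [RCLike F] : Type _ := GL (Fin n) F ⋊[sigmaAut n F] ℤˣ

/-- The character of `GL(V) ⋊ {1, σ}` which is `1` on `GL(V)` and `-1` off `GL(V)`. -/
def chi (n : ℕ) (F : Type*) [RCLike F] : GTilde n F →* ℂˣ :=
  (Units.map (Int.castRingHom ℂ).toMonoidHom).comp SemidirectProduct.rightHom

theorem chi_inl {n : ℕ} {F : Type*} [RCLike F] (g : GL (Fin n) F) :
    chi n F (SemidirectProduct.inl g) = 1 := by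
  simp [chi]

theorem chi_sigma {n : ℕ} {F : Type*} [RCLike F] :
    chi n F (SemidirectProduct.inr (-1)) = -1 := by
  ext
  simp [chi]

/-- The action `g(A, v, φ) = (g A g⁻¹, g v, φ g⁻¹)` of `GL(V)` on `X`. -/
def glAct (n : ℕ) (F : Type*) [RCLike F] : GL (Fin n) F →* (XSpace n F ≃ₗ[F] XSpace n F) where
  toFun g :=
    { toFun := fun x => (⟨g.val * x.1.val * (g⁻¹).val, by
        have hx : Matrix.trace x.1.val = 0 := x.1.2
        rw [LinearMap.mem_ker, Matrix.traceLinearMap_apply, Matrix.trace_mul_comm, ← mul_assoc,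
          Units.inv_mul, one_mul, hx]⟩, g.val *ᵥ x.2.1, x.2.2 ᵥ* (g⁻¹).val)
      invFun := fun x => (⟨(g⁻¹).val * x.1.val * g.val, by
        have hx : Matrix.trace x.1.val = 0 := x.1.2
        rw [LinearMap.mem_ker, Matrix.traceLinearMap_apply, Matrix.trace_mul_comm, ← mul_assoc,
          Units.mul_inv, one_mul, hx]⟩, (g⁻¹).val *ᵥ x.2.1, x.2.2 ᵥ* g.val)
      map_add' := fun x y => by
        refine Prod.ext (Subtype.ext ?_) (Prod.ext ?_ ?_)
        · exact (congrArg (· * (g⁻¹).val) (mul_add _ _ _)).trans (add_mul _ _ _)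
        · exact Matrix.mulVec_add g.val x.2.1 y.2.1
        · exact Matrix.add_vecMul (g⁻¹).val x.2.2 y.2.2
      map_smul' := fun c x => by
        refine Prod.ext (Subtype.ext ?_) (Prod.ext ?_ ?_)
        · exact (congrArg (· * (g⁻¹).val) (mul_smul_comm _ _ _)).trans (smul_mul_assoc _ _ _)
        · exact Matrix.mulVec_smul g.val c x.2.1
        · exact Matrix.smul_vecMul c x.2.2 (g⁻¹).val
      left_inv := fun x => by
        refine Prod.ext (Subtype.ext ?_) (Prod.ext ?_ ?_)
        · change (g⁻¹).val * (g.val * x.1.val * (g⁻¹).val) * g.val = x.1.val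
          simp only [mul_assoc, Units.inv_mul, mul_one]
          rw [← mul_assoc, Units.inv_mul, one_mul]
        · simp [Matrix.mulVec_mulVec]
        · simp [Matrix.vecMul_vecMul]
      right_inv := fun x => by
        refine Prod.ext (Subtype.ext ?_) (Prod.ext ?_ ?_)
        · change g.val * ((g⁻¹).val * x.1.val * g.val) * (g⁻¹).val = x.1.val
          simp only [mul_assoc, Units.mul_inv, mul_one]
          rw [← mul_assoc, Units.mul_inv, one_mul]
        · simp [Matrix.mulVec_mulVec]
        · simp [Matrix.vecMul_vecMul] }
  map_one' := by
    refine LinearEquiv.ext fun x => Prod.ext (Subtype.ext ?_) (Prod.ext ?_ ?_) <;> simp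
  map_mul' g h := by
    refine LinearEquiv.ext fun x => Prod.ext (Subtype.ext ?_) (Prod.ext ?_ ?_)
    · simp [mul_assoc]
    · simp [Matrix.mulVec_mulVec]
    · simp [Matrix.vecMul_vecMul]

/-- The involution `σ(A, v, φ) = (Aᵗ, φᵗ, vᵗ)` of `X`. -/
def sigmaAct (n : ℕ) (F : Type*) [RCLike F] : XSpace n F ≃ₗ[F] XSpace n F where
  toFun x := (⟨x.1.valᵀ, by
    have hx : Matrix.trace x.1.val = 0 := x.1.2
    rw [LinearMap.mem_ker, Matrix.traceLinearMap_apply, Matrix.trace_transpose, hx]⟩,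
    x.2.2, x.2.1)
  invFun x := (⟨x.1.valᵀ, by
    have hx : Matrix.trace x.1.val = 0 := x.1.2
    rw [LinearMap.mem_ker, Matrix.traceLinearMap_apply, Matrix.trace_transpose, hx]⟩,
    x.2.2, x.2.1)
  map_add' _ _ := rfl
  map_smul' _ _ := rfl
  left_inv _ := rfl
  right_inv _ := rfl

/-- The action of `GL(V) ⋊ {1, σ}` on `X` extending those of `GL(V)` and of `σ`. -/
def gTildeAct (n : ℕ) (F : Type*) [RCLike F] : GTilde n F →* (XSpace n F ≃ₗ[F] XSpace n F) :=
  SemidirectProduct.lift (glAct n F)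
    (involutionHom (sigmaAct n F) (LinearEquiv.ext fun _ => rfl)) fun s => by
      rcases Int.units_eq_one_or s with rfl | rfl
      · ext g : 1
        simp
      · refine MonoidHom.ext fun g => LinearEquiv.ext fun x => ?_
        change glAct n F (transposeInv n F g) x =
          sigmaAct n F (glAct n F g (sigmaAct n F x))
        refine Prod.ext (Subtype.ext ?_) (Prod.ext ?_ ?_)
        · change (g⁻¹).valᵀ * x.1.val * (g.val)ᵀ = (g.val * x.1.valᵀ * (g⁻¹).val)ᵀ
          simp only [Matrix.transpose_mul, Matrix.transpose_transpose, mul_assoc]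
        · exact Matrix.mulVec_transpose (g⁻¹).val x.2.1
        · exact Matrix.vecMul_transpose g.val x.2.2

theorem gTildeAct_inl {n : ℕ} {F : Type*} [RCLike F] (g : GL (Fin n) F) :
    gTildeAct n F (SemidirectProduct.inl g) = glAct n F g :=
  SemidirectProduct.lift_inl _ _ _ _

theorem gTildeAct_sigma {n : ℕ} {F : Type*} [RCLike F] :
    gTildeAct n F (SemidirectProduct.inr (-1)) = sigmaAct n F :=
  (SemidirectProduct.lift_inr _ _ _ _).trans (involutionHom_neg_one _ _)

/-- The action of an element of `GL(V) ⋊ {1, σ}` as a homeomorphism of `X`. -/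
def gTildeEquiv {n : ℕ} {F : Type*} [RCLike F] (g : GTilde n F) : XSpace n F ≃L[ℝ] XSpace n F :=
  ((gTildeAct n F g).restrictScalars ℝ).toContinuousLinearEquiv

/-- `ξ` is an element of the space `S*(X)^{GTilde, χ}`: one has `g ξ = χ(g) ξ` for every `g`, where
`(g ξ)(f) = ξ(f ∘ g)` for each Schwartz function `f` on `X`. -/
def IsChiEquivariant {n : ℕ} {F : Type*} [RCLike F] (ξ : 𝓢'(XSpace n F, ℂ)) : Prop :=
  ∀ (g : GTilde n F) (f : 𝓢(XSpace n F, ℂ)),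
    ξ (SchwartzMap.compCLMOfContinuousLinearEquiv ℂ (gTildeEquiv g) f) = chi n F g * ξ f

/-! ### The partial Fourier transform in `V × V*` -/

/-- The standard symmetric bilinear form on `V × V*`: `B((v, φ), (w, ψ)) = φ(w) + ψ(v)`. -/
def pairing {n : ℕ} {F : Type*} [RCLike F] (x y : VVdual n F) : F :=
  x.2 ⬝ᵥ y.1 + y.2 ⬝ᵥ x.1

/-- The partial Fourier integral of `f : X → ℂ` in the variable `w ∈ V × V*`, with respect to
the additive character `κ(t) = exp (2 π i Re t)` of `F`, the bilinear form `pairing`, and the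
Lebesgue measure on `V × V*`, which is the corresponding self-dual Haar measure. -/
def partialFourierFun {n : ℕ} {F : Type*} [RCLike F] (f : XSpace n F → ℂ) (x : XSpace n F) : ℂ :=
  ∫ w : VVdual n F, (Real.fourierChar (RCLike.re (pairing w x.2)) : ℂ) * f (x.1, w)

/-- The continuous real bilinear form `-Re B` on `V × V*`. -/
def negRePairing (n : ℕ) (F : Type*) [RCLike F] : VVdual n F →L[ℝ] VVdual n F →L[ℝ] ℝ :=
  (LinearMap.mk₂ ℝ (fun x y : VVdual n F => -RCLike.re (pairing x y))
    (fun x y z => by simp [pairing, add_dotProduct, dotProduct_add]; ring)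
    (fun c x y => by simp [pairing, smul_dotProduct, dotProduct_smul, RCLike.smul_re]; ring)
    (fun x y z => by simp [pairing, add_dotProduct, dotProduct_add]; ring)
    (fun c x y => by
      simp [pairing, smul_dotProduct, dotProduct_smul, RCLike.smul_re]; ring)).toContinuousBilinearMap

theorem negRePairing_apply {n : ℕ} {F : Type*} [RCLike F] (x y : VVdual n F) :
    negRePairing n F x y = -RCLike.re (pairing x y) := rfl

theorem negRePairing_nondeg (n : ℕ) (F : Type*) [RCLike F] (w : VVdual n F) :
    ∃ v, ‖v‖ ≤ 1 ∧ ‖w‖ ≤ |negRePairing n F v w| := by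
  rcases eq_or_ne w 0 with rfl | hw
  · exact ⟨0, by simp, by simp⟩
  have hw' : 0 < ‖w‖ := norm_pos_iff.2 hw
  set u : VVdual n F := (star w.2, star w.1)
  have hu : ‖u‖ = ‖w‖ := by simp [u, Prod.norm_def, max_comm]
  have hsum : ∀ z : Fin n → F, ‖z‖ ^ 2 ≤ ∑ i, ‖z i‖ ^ 2 := by
    intro z
    have h0 : 0 ≤ ∑ i, ‖z i‖ ^ 2 := Finset.sum_nonneg fun i _ => by positivity
    rw [← Real.sqrt_le_sqrt_iff h0, Real.sqrt_sq (norm_nonneg _)]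
    refine (pi_norm_le_iff_of_nonneg (Real.sqrt_nonneg _)).2 fun i => Real.le_sqrt_of_sq_le ?_
    exact Finset.single_le_sum (f := fun i => ‖z i‖ ^ 2) (fun i _ => by positivity)
      (Finset.mem_univ i)
  have hre : ∀ z : Fin n → F, RCLike.re (star z ⬝ᵥ z) = ∑ i, ‖z i‖ ^ 2 := by
    intro z
    simp only [dotProduct, map_sum, Pi.star_apply, RCLike.star_def, RCLike.conj_mul]
    exact Finset.sum_congr rfl fun i _ => by norm_cast
  have key : ‖w‖ ^ 2 ≤ RCLike.re (pairing u w) := by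
    have e : pairing u w = star w.1 ⬝ᵥ w.1 + star w.2 ⬝ᵥ w.2 := by
      simp only [pairing, u]
      rw [dotProduct_comm w.2]
    rw [e, map_add, hre, hre]
    have h1 := hsum w.1
    have h2 := hsum w.2
    rcases le_total ‖w.1‖ ‖w.2‖ with h | h
    · rw [Prod.norm_def, max_eq_right h]; nlinarith [sq_nonneg ‖w.1‖]
    · rw [Prod.norm_def, max_eq_left h]; nlinarith [sq_nonneg ‖w.2‖]
  refine ⟨‖w‖⁻¹ • u, ?_, ?_⟩
  · rw [norm_smul, hu, norm_inv, norm_norm, inv_mul_cancel₀ hw'.ne']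
  · rw [map_smul, smul_apply, negRePairing_apply, smul_eq_mul, abs_mul, abs_neg, abs_inv,
      abs_norm, inv_mul_eq_div, le_div_iff₀ hw', ← sq]
    exact key.trans (le_abs_self _)

instance VVdual.isAddHaarMeasure_volume (n : ℕ) (F : Type*) [RCLike F] :
    (volume : Measure (VVdual n F)).IsAddHaarMeasure :=
  Measure.prod.instIsAddHaarMeasure (volume : Measure (Fin n → F)) (volume : Measure (Fin n → F))

theorem partialFourierFun_eq_pft {n : ℕ} {F : Type*} [RCLike F] (f : XSpace n F → ℂ) :
    partialFourierFun f = PartialFT.pft volume (negRePairing n F) f := by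
  funext x
  simp only [partialFourierFun, PartialFT.pft_def, negRePairing_apply, neg_neg, smul_eq_mul]

/-- The partial Fourier transform of Schwartz functions on `X`. -/
def partialFourierSchwartz (n : ℕ) (F : Type*) [RCLike F] :
    𝓢(XSpace n F, ℂ) →L[ℂ] 𝓢(XSpace n F, ℂ) :=
  SchwartzMap.mkCLM (fun f => partialFourierFun f)
    (fun f g x => by
      simp only [partialFourierFun_eq_pft]
      exact PartialFT.pft_add volume (negRePairing n F) f g x)
    (fun c f x => by
      simp only [partialFourierFun_eq_pft]
      exact PartialFT.pft_smul volume (negRePairing n F) c f x)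
    (fun f => by
      rw [partialFourierFun_eq_pft]
      exact PartialFT.contDiff_pft volume (negRePairing n F) f)
    (fun m => by
      simp only [partialFourierFun_eq_pft]
      exact PartialFT.bound_schwartz volume (negRePairing n F) (negRePairing_nondeg n F) m)

theorem partialFourierSchwartz_apply {n : ℕ} {F : Type*} [RCLike F] (f : 𝓢(XSpace n F, ℂ))
    (x : XSpace n F) : partialFourierSchwartz n F f x = partialFourierFun f x := rfl

/-- The partial Fourier transform of Schwartz distributions on `X`, by duality. -/
def partialFourier {n : ℕ} {F : Type*} [RCLike F] (ξ : 𝓢'(XSpace n F, ℂ)) : 𝓢'(XSpace n F, ℂ) :=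
  PointwiseConvergenceCLM.precomp ℂ (partialFourierSchwartz n F) ξ

theorem partialFourier_apply {n : ℕ} {F : Type*} [RCLike F] (ξ : 𝓢'(XSpace n F, ℂ))
    (f : 𝓢(XSpace n F, ℂ)) : partialFourier ξ f = ξ (partialFourierSchwartz n F f) := rfl

/-- The cross `C = (V × 0) ∪ (0 × V*)` in `V × V*`. -/
def cross (n : ℕ) (F : Type*) [RCLike F] : Set (VVdual n F) :=
  (Set.univ ×ˢ {0}) ∪ ({0} ×ˢ Set.univ)

/-- The subset `sl(V) × C` of `X`. -/
def slTimesCross (n : ℕ) (F : Type*) [RCLike F] : Set (XSpace n F) :=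
  Set.univ ×ˢ cross n F

end

/-!
Let `x₁, …, xₘ` be real coordinates on `V` and `y₁, …, yₘ` real coordinates on `V*`; the variable
`A ∈ sl(V)` is a passive parameter throughout.

* All products `xᵢ yⱼ` vanish on the cross. Since `ξ` has finite order, some power of each `xᵢ yⱼ`
  kills `ξ` (`TemperedDistribution.exists_pow_smul_eq_zero`).
* The same holds for the Fourier transform of `ξ`, so that some power of each `∂/∂xᵢ ∂/∂yⱼ` kills
  `ξ` (`exists_derivOp_pow_eq_zero`, by Fourier inversion for the partial transform).
* The scalar matrices `exp(τ)` fix `A` and act by `(v, φ) ↦ (exp(τ) v, exp(-τ) φ)`. Differentiating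
  the invariance of `ξ` at `τ = 0` gives that `∑ aᵢ - ∑ bⱼ` kills `ξ`, where `aᵢ = xᵢ ∂/∂xᵢ` and
  `bⱼ = yⱼ ∂/∂yⱼ` act on test functions (`IsChiEquivariant.apply_flowGen_eq_zero`).

The identities `xᵏ ∂ᵏ = a (a - 1) ⋯ (a - k + 1)` and `∂ᵏ xᵏ = (a + 1) ⋯ (a + k)` turn the first two
facts into relations between the commuting operators `aᵢ`, `bⱼ`: for joint eigenvalues, for all `i`
and `j`, one of `aᵢ`, `bⱼ` is a natural number and one of them is a negative integer. Hence all `aᵢ`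
are natural numbers and all `bⱼ` are negative, or the reverse, and `∑ aᵢ - ∑ bⱼ` cannot be zero when
`m > 0` (`LinearMap.eq_zero_of_weyl`). Only the invariance under positive scalar matrices enters
when `n > 0`; the involution `σ` is needed for `n = 0`.
-/

open scoped IsMulCommutative
open Polynomial (aeval aeval_X aeval_def eval₂_eq_eval_map)

/-! ### Canonical commutation relations -/

section Weyl

variable {R : Type*} [Ring R] {x d y e : R}

/-- A relation `d x = x d + 1` makes `d` lower the degree, which is the eigenvalue of `x d`. -/
theorem pow_mul_euler_of_comm (h : d * x = x * d + 1) (k : ℕ) :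
    d ^ k * (x * d) = (x * d + k) * d ^ k := by
  induction k with
  | zero => simp
  | succ k ih =>
    have h1 : d * (x * d) = (x * d + 1) * d := by rw [← mul_assoc, h]
    rw [pow_succ', mul_assoc, ih, ← mul_assoc, mul_add, h1, ← Nat.cast_commute k d |>.eq,
      ← add_mul, mul_assoc, Nat.cast_succ]
    congr 1
    abel

theorem euler_mul_pow_of_comm (h : d * x = x * d + 1) (k : ℕ) :
    d ^ k * (x * d + 1) = (x * d + 1 + k) * d ^ k := by
  rw [mul_add, pow_mul_euler_of_comm h, mul_one, add_right_comm, add_mul _ 1, one_mul]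

theorem pow_mul_pow_eq_aeval [Algebra ℂ R] (h : d * x = x * d + 1) (k : ℕ) :
    x ^ k * d ^ k = aeval (x * d) (descPochhammer ℂ k) := by
  induction k with
  | zero => simp
  | succ k ih =>
    rw [descPochhammer_succ_right, map_mul, ← ih]
    simp only [map_sub, aeval_X, map_natCast]
    rw [mul_sub, mul_assoc, pow_mul_euler_of_comm h, add_mul, mul_add, mul_assoc (x ^ k) (d ^ k),
      ← (Nat.cast_commute k (d ^ k)).eq, add_sub_cancel_right, pow_succ, pow_succ']
    simp only [mul_assoc]

theorem derivative_pow_mul_pow_eq_aeval [Algebra ℂ R] (h : d * x = x * d + 1) (k : ℕ) :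
    d ^ k * x ^ k = aeval (x * d + 1) (ascPochhammer ℂ k) := by
  induction k with
  | zero => simp
  | succ k ih =>
    rw [ascPochhammer_succ_right, mul_comm, map_mul, ← ih]
    simp only [map_add, aeval_X, map_natCast]
    rw [pow_succ, pow_succ', mul_assoc, ← mul_assoc d, h, ← mul_assoc, euler_mul_pow_of_comm h,
      mul_assoc]

end Weyl

theorem exists_eq_of_aeval_descPochhammer_eq_zero {K : Type*} [Field K] [Algebra ℂ K] {a : K}
    {k : ℕ} (h : aeval a (descPochhammer ℂ k) = 0) : ∃ s : ℕ, a = s := by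
  rw [aeval_def, eval₂_eq_eval_map, descPochhammer_map, descPochhammer_eval_eq_prod_range,
    Finset.prod_eq_zero_iff] at h
  obtain ⟨s, -, hs⟩ := h
  exact ⟨s, sub_eq_zero.1 hs⟩

theorem exists_eq_of_aeval_ascPochhammer_eq_zero {K : Type*} [Field K] [Algebra ℂ K] {a : K}
    {k : ℕ} (h : aeval (a + 1) (ascPochhammer ℂ k) = 0) : ∃ s : ℕ, a = -(s + 1) := by
  rw [aeval_def, eval₂_eq_eval_map, ascPochhammer_map, ascPochhammer_eval_eq_zero_iff] at h
  obtain ⟨s, -, hs⟩ := h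
  exact ⟨s, by rw [hs]; ring⟩

/-- If one of `a i`, `b j` is a natural number and one of them is a negative integer, for all `i`
and `j`, then either all `a i` are natural numbers and all `b j` are negative, or the reverse. -/
theorem sum_ne_sum_of_nat_neg {K ι : Type*} [Field K] [CharZero K] [Fintype ι] [Nonempty ι]
    {a b : ι → K} (h : ∀ i j, (∃ s : ℕ, a i = s) ∨ ∃ s : ℕ, b j = s)
    (h' : ∀ i j, (∃ s : ℕ, a i = -(s + 1)) ∨ ∃ s : ℕ, b j = -(s + 1)) :
    ∑ i, a i ≠ ∑ j, b j := by
  have excl : ∀ {c : K}, (∃ s : ℕ, c = s) → ¬ ∃ s : ℕ, c = -(s + 1) := by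
    rintro c ⟨s, rfl⟩ ⟨t, ht⟩
    have : ((s + t + 1 : ℕ) : K) = 0 := by push_cast; rw [ht]; ring
    exact absurd (Nat.cast_eq_zero.1 this) (by omega)
  have key : ∀ {c d : ι → K}, (∀ i, ∃ s : ℕ, c i = s) → (∀ i, ∃ s : ℕ, d i = -(s + 1)) →
      ∑ i, c i ≠ ∑ i, d i := by
    intro c d hc hd hsum
    choose s hs using hc
    choose t ht using hd
    have : ((∑ i, (s i + (t i + 1)) : ℕ) : K) = 0 := by
      push_cast
      rw [Finset.sum_add_distrib, ← Finset.sum_congr rfl fun i _ => hs i, hsum,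
        Finset.sum_congr rfl fun i _ => ht i, ← Finset.sum_add_distrib]
      simp
    rw [Nat.cast_eq_zero, Finset.sum_eq_zero_iff] at this
    have := this (Classical.arbitrary ι) (Finset.mem_univ _)
    omega
  by_cases hex : ∃ i, ∃ s : ℕ, a i = s
  · obtain ⟨i₀, hi₀⟩ := hex
    have hb : ∀ j, ∃ s : ℕ, b j = -(s + 1) := fun j => (h' i₀ j).resolve_left (excl hi₀)
    have ha : ∀ i, ∃ s : ℕ, a i = s := fun i =>
      (h i i₀).resolve_right fun hn => excl hn (hb i₀)
    exact key ha hb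
  · have hb : ∀ j, ∃ s : ℕ, b j = s := fun j =>
      (h (Classical.arbitrary ι) j).resolve_left fun hn => hex ⟨_, hn⟩
    have ha : ∀ i, ∃ s : ℕ, a i = -(s + 1) := fun i =>
      (h' i (Classical.arbitrary ι)).resolve_right (excl (hb _))
    exact (key hb ha).symm

/-- A functional `ξ` on a module over the Weyl algebra in the variables `xᵢ`, `yⱼ` is zero if powers
of all `xᵢ yⱼ` and of all `∂ᵢ ∂ⱼ` kill it, and so does the difference of the two Euler operators.
If not, the annihilator of `ξ` in the commutative algebra generated by the operators `xᵢ ∂ᵢ` and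
`yⱼ ∂ⱼ` lies in a maximal ideal. In its residue field the image of one of `xᵢ ∂ᵢ`, `yⱼ ∂ⱼ` is a
natural number and the image of the other is a negative integer, whatever `i` and `j` are. -/
theorem LinearMap.eq_zero_of_weyl {M ι : Type*} [AddCommGroup M] [Module ℂ M] [Fintype ι]
    [Nonempty ι] (ξ : M →ₗ[ℂ] ℂ) (x d y e : ι → Module.End ℂ M)
    (hdx : ∀ i, d i * x i = x i * d i + 1) (hey : ∀ i, e i * y i = y i * e i + 1)
    (hxx : ∀ i j, i ≠ j → Commute (x i * d i) (x j * d j))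
    (hyy : ∀ i j, i ≠ j → Commute (y i * e i) (y j * e j))
    (hxy : ∀ i j, Commute (x i) (y j)) (hxe : ∀ i j, Commute (x i) (e j))
    (hdy : ∀ i j, Commute (d i) (y j)) (hde : ∀ i j, Commute (d i) (e j))
    (hmul : ∀ i j, ∃ k, ∀ m, ξ (((x i * y j) ^ k) m) = 0)
    (hder : ∀ i j, ∃ k, ∀ m, ξ (((d i * e j) ^ k) m) = 0)
    (hinv : ∀ m, ξ ((∑ i, x i * d i - ∑ j, y j * e j) m) = 0) : ξ = 0 := by
  by_contra hξ
  set T : Set (Module.End ℂ M) :=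
    Set.range (fun i => x i * d i) ∪ Set.range (fun j => y j * e j) with hT
  have hab : ∀ i j, Commute (x i * d i) (y j * e j) := fun i j =>
    ((hxy i j).mul_right (hxe i j)).mul_left ((hdy i j).mul_right (hde i j))
  have hcomm : ∀ p ∈ T, ∀ q ∈ T, p * q = q * p := by
    rintro _ (⟨i, rfl⟩ | ⟨i, rfl⟩) _ (⟨j, rfl⟩ | ⟨j, rfl⟩)
    · by_cases h : i = j
      · rw [h]
      · exact hxx i j h
    · exact hab i j
    · exact (hab j i).symm
    · by_cases h : i = j
      · rw [h]
      · exact hyy i j h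
  have := Algebra.isMulCommutative_adjoin ℂ hcomm
  set a : ι → Algebra.adjoin ℂ T := fun i =>
    ⟨x i * d i, Algebra.subset_adjoin (Or.inl ⟨i, rfl⟩)⟩
  set b : ι → Algebra.adjoin ℂ T := fun i =>
    ⟨y i * e i, Algebra.subset_adjoin (Or.inr ⟨i, rfl⟩)⟩
  let I : Ideal (Algebra.adjoin ℂ T) :=
    { carrier := {r | ∀ m, ξ (r.1 m) = 0}
      add_mem' := fun {r s} hr hs m => by
        change ξ (r.1 m + s.1 m) = 0
        rw [map_add, hr, hs, add_zero]
      zero_mem' := fun m => map_zero ξ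
      smul_mem' := fun c r hr m => by
        rw [smul_eq_mul, mul_comm]
        exact hr (c.1 m) }
  have hI : I ≠ ⊤ := fun h => hξ (LinearMap.ext fun m => by
    have h1 : (1 : Algebra.adjoin ℂ T) ∈ I := h ▸ Submodule.mem_top
    exact h1 m)
  obtain ⟨𝔪, hmax, hle⟩ := Ideal.exists_le_maximal I hI
  let : Field (Algebra.adjoin ℂ T ⧸ 𝔪) := Ideal.Quotient.field 𝔪
  have : CharZero (Algebra.adjoin ℂ T ⧸ 𝔪) :=
    charZero_of_injective_algebraMap (algebraMap ℂ (Algebra.adjoin ℂ T ⧸ 𝔪)).injective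
  let π : Algebra.adjoin ℂ T →ₐ[ℂ] Algebra.adjoin ℂ T ⧸ 𝔪 := Ideal.Quotient.mkₐ ℂ 𝔪
  have hπ : ∀ r ∈ I, π r = 0 := fun r hr => Ideal.Quotient.eq_zero_iff_mem.2 (hle hr)
  have hval : ∀ (r : Algebra.adjoin ℂ T) (p : Polynomial ℂ), (aeval r p).1 = aeval r.1 p :=
    fun r p => (Polynomial.aeval_algHom_apply (Algebra.adjoin ℂ T).val r p).symm
  refine sum_ne_sum_of_nat_neg (a := fun i => π (a i)) (b := fun j => π (b j)) (fun i j => ?_)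
    (fun i j => ?_) ?_
  · obtain ⟨k, hk⟩ := hmul i j
    -- `x ^ k y ^ k ∂ₓ ^ k ∂ᵧ ^ k` is the product of the two falling factorials
    have hmem : aeval (a i) (descPochhammer ℂ k) * aeval (b j) (descPochhammer ℂ k) ∈ I := by
      intro m
      change ξ (((aeval (a i) (descPochhammer ℂ k)).1 * (aeval (b j) (descPochhammer ℂ k)).1) m) = 0
      rw [hval, hval, ← pow_mul_pow_eq_aeval (hdx i), ← pow_mul_pow_eq_aeval (hey j), mul_assoc,
        ← mul_assoc (d i ^ k), ((hdy i j).pow_pow k k).eq, mul_assoc, ← mul_assoc,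
        ← (hxy i j).mul_pow]
      exact hk _
    have h0 := hπ _ hmem
    rw [map_mul, ← Polynomial.aeval_algHom_apply, ← Polynomial.aeval_algHom_apply] at h0
    exact (mul_eq_zero.1 h0).imp exists_eq_of_aeval_descPochhammer_eq_zero
      exists_eq_of_aeval_descPochhammer_eq_zero
  · obtain ⟨k, hk⟩ := hder i j
    -- `∂ₓ ^ k ∂ᵧ ^ k x ^ k y ^ k` is the product of the two rising factorials
    have hmem : aeval (a i + 1) (ascPochhammer ℂ k) * aeval (b j + 1) (ascPochhammer ℂ k) ∈ I := by
      intro m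
      change ξ (((aeval (a i + 1) (ascPochhammer ℂ k)).1 *
        (aeval (b j + 1) (ascPochhammer ℂ k)).1) m) = 0
      rw [hval, hval]
      change ξ ((aeval (x i * d i + 1) (ascPochhammer ℂ k) *
        aeval (y j * e j + 1) (ascPochhammer ℂ k)) m) = 0
      rw [← derivative_pow_mul_pow_eq_aeval (hdx i), ← derivative_pow_mul_pow_eq_aeval (hey j),
        mul_assoc, ← mul_assoc (x i ^ k), ((hxe i j).pow_pow k k).eq, mul_assoc, ← mul_assoc,
        ← (hde i j).mul_pow]
      exact hk _
    have h0 := hπ _ hmem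
    rw [map_mul, ← Polynomial.aeval_algHom_apply, ← Polynomial.aeval_algHom_apply, map_add, map_add,
      map_one] at h0
    exact (mul_eq_zero.1 h0).imp exists_eq_of_aeval_ascPochhammer_eq_zero
      exists_eq_of_aeval_ascPochhammer_eq_zero
  · have hmem : ∑ i, a i - ∑ j, b j ∈ I := by
      intro m
      have : (∑ i, a i - ∑ j, b j).1 = ∑ i, x i * d i - ∑ j, y j * e j := by
        simp [a, b]
      rw [this]
      exact hinv m
    have h0 := hπ _ hmem
    rwa [map_sub, map_sum, map_sum, sub_eq_zero] at h0

/-! ### Cut-offs of Schwartz functions -/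

section Cutoff

universe u

variable {E : Type u} {H : Type*} [NormedAddCommGroup E] [NormedSpace ℝ E]
  [NormedAddCommGroup H] [NormedSpace ℝ H] {s : E → ℝ} {L : E →L[ℝ] E →L[ℝ] ℝ}

/-- A function with linear derivative, that is, a quadratic one, is smooth. -/
theorem contDiff_of_hasFDerivAt_clm (hs : ∀ x, HasFDerivAt s (L x) x) : ContDiff ℝ ∞ s := by
  rw [contDiff_infty_iff_fderiv]
  refine ⟨fun x => (hs x).differentiableAt, ?_⟩
  rw [funext fun x => (hs x).fderiv]
  exact L.contDiff

theorem fderiv_cutoff (hs : ∀ x, HasFDerivAt s (L x) x) (h : 𝓢(ℝ, ℝ)) (f : 𝓢(E, H)) (r : ℝ) :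
    fderiv ℝ (fun x => h (r * s x) • f x) =
      (r • fun x => SchwartzMap.derivCLM ℝ ℝ h (r * s x) • SchwartzMap.smulRightCLM ℝ H L f x) +
        fun x => h (r * s x) • SchwartzMap.fderivCLM ℝ E H f x := by
  funext x
  have h1 : HasFDerivAt (fun x => h (r * s x)) ((deriv h (r * s x)) • (r • L x)) x :=
    (h.hasDerivAt (r * s x)).comp_hasFDerivAt x ((hs x).const_mul r)
  refine (h1.smul (f.hasFDerivAt x)).fderiv.trans ?_
  ext y
  simp [smul_smul, mul_comm, mul_left_comm, add_comm]

/-- The derivative of `h (r s) f` is a sum of two functions of the same form, with values in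
`E →L[ℝ] H`, and one of the two has a factor `r`. -/
theorem cutoff_bound_succ (hs : ∀ x, HasFDerivAt s (L x) x) (j : ℕ)
    (ih : ∀ (h : 𝓢(ℝ, ℝ)) (f : 𝓢(E, E →L[ℝ] H)) (k : ℕ), ∃ C, 0 ≤ C ∧ ∀ r : ℝ, 0 ≤ r → ∀ x,
      ‖x‖ ^ k * ‖iteratedFDeriv ℝ j (fun x => h (r * s x) • f x) x‖ ≤ C * (1 + r) ^ j)
    (h : 𝓢(ℝ, ℝ)) (f : 𝓢(E, H)) (k : ℕ) : ∃ C, 0 ≤ C ∧ ∀ r : ℝ, 0 ≤ r → ∀ x,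
      ‖x‖ ^ k * ‖iteratedFDeriv ℝ (j + 1) (fun x => h (r * s x) • f x) x‖ ≤
        C * (1 + r) ^ (j + 1) := by
  obtain ⟨C₁, hC₁, h₁⟩ := ih (SchwartzMap.derivCLM ℝ ℝ h) (SchwartzMap.smulRightCLM ℝ H L f) k
  obtain ⟨C₂, hC₂, h₂⟩ := ih h (SchwartzMap.fderivCLM ℝ E H f) k
  refine ⟨C₁ + C₂, by positivity, fun r hr x => ?_⟩
  have hsC := contDiff_of_hasFDerivAt_clm hs
  have hsm : ∀ (h : 𝓢(ℝ, ℝ)) (f : 𝓢(E, E →L[ℝ] H)),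
      ContDiff ℝ j fun x => h (r * s x) • f x := fun h f =>
    ((h.smooth j).comp ((contDiff_const.mul hsC).of_le (mod_cast le_top))).smul (f.smooth j)
  have hsm' : ContDiff ℝ j (r • fun x => SchwartzMap.derivCLM ℝ ℝ h (r * s x) •
      SchwartzMap.smulRightCLM ℝ H L f x) := contDiff_const.smul (hsm _ _)
  rw [← norm_iteratedFDeriv_fderiv, fderiv_cutoff hs,
    iteratedFDeriv_add_apply hsm'.contDiffAt (hsm _ _).contDiffAt,
    iteratedFDeriv_const_smul_apply (hsm _ _).contDiffAt]
  calc _ ≤ ‖x‖ ^ k * (r * ‖iteratedFDeriv ℝ j (fun x => SchwartzMap.derivCLM ℝ ℝ h (r * s x) •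
          SchwartzMap.smulRightCLM ℝ H L f x) x‖ + ‖iteratedFDeriv ℝ j (fun x => h (r * s x) •
          SchwartzMap.fderivCLM ℝ E H f x) x‖) := by
        gcongr
        refine (norm_add_le _ _).trans ?_
        rw [norm_smul, Real.norm_of_nonneg hr]
    _ ≤ r * (C₁ * (1 + r) ^ j) + C₂ * (1 + r) ^ j := by
        rw [mul_add, mul_left_comm]
        exact add_le_add (mul_le_mul_of_nonneg_left (h₁ r hr x) hr) (h₂ r hr x)
    _ ≤ _ := by
        have : 0 ≤ (1 + r) ^ j := by positivity
        rw [pow_succ]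
        nlinarith [mul_nonneg hC₁ this, mul_nonneg (mul_nonneg hC₂ this) hr]

theorem cutoff_bound_zero (h : 𝓢(ℝ, ℝ)) (f : 𝓢(E, H)) (k : ℕ) : ∃ C, 0 ≤ C ∧
    ∀ r : ℝ, 0 ≤ r → ∀ x,
      ‖x‖ ^ k * ‖iteratedFDeriv ℝ 0 (fun x => h (r * s x) • f x) x‖ ≤ C * (1 + r) ^ 0 := by
  refine ⟨SchwartzMap.seminorm ℝ 0 0 h * SchwartzMap.seminorm ℝ k 0 f, by positivity,
    fun r hr x => ?_⟩
  rw [norm_iteratedFDeriv_zero, norm_smul, mul_left_comm, pow_zero, mul_one]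
  gcongr
  · exact SchwartzMap.norm_le_seminorm ℝ h _
  · exact SchwartzMap.norm_pow_mul_le_seminorm ℝ f k x

theorem cutoff_bound_aux (hs : ∀ x, HasFDerivAt s (L x) x) (j : ℕ) :
    ∀ (H : Type u) [NormedAddCommGroup H] [NormedSpace ℝ H] (h : 𝓢(ℝ, ℝ)) (f : 𝓢(E, H)) (k : ℕ),
      ∃ C, 0 ≤ C ∧ ∀ r : ℝ, 0 ≤ r → ∀ x,
        ‖x‖ ^ k * ‖iteratedFDeriv ℝ j (fun x => h (r * s x) • f x) x‖ ≤ C * (1 + r) ^ j := by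
  induction j with
  | zero => intro H _ _ h f k; exact cutoff_bound_zero h f k
  | succ j ih => intro H _ _ h f k; exact cutoff_bound_succ hs j (ih _) h f k

/-- The derivatives of order `j` of `h (r s) f` grow at most like `r ^ j`. -/
theorem cutoff_bound (hs : ∀ x, HasFDerivAt s (L x) x) (h : 𝓢(ℝ, ℝ)) (f : 𝓢(E, ℂ)) (k j : ℕ) :
    ∃ C, 0 ≤ C ∧ ∀ r : ℝ, 0 ≤ r → ∀ x,
      ‖x‖ ^ k * ‖iteratedFDeriv ℝ j (fun x => h (r * s x) • f x) x‖ ≤ C * (1 + r) ^ j := by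
  cases j with
  | zero => exact cutoff_bound_zero h f k
  | succ j => exact cutoff_bound_succ hs j (cutoff_bound_aux hs j _) h f k

/-- A tempered distribution has finite order. -/
theorem TemperedDistribution.exists_norm_le_sum_seminorm (ξ : 𝓢'(E, ℂ)) :
    ∃ (S : Finset (ℕ × ℕ)) (C : ℝ), 0 ≤ C ∧ ∀ f : 𝓢(E, ℂ),
      ‖ξ f‖ ≤ C * ∑ i ∈ S, SchwartzMap.seminorm ℂ i.1 i.2 f := by
  obtain ⟨S, C, -, h⟩ := Seminorm.bound_of_continuous (schwartz_withSeminorms ℂ E ℂ)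
    ((normSeminorm ℂ ℂ).comp ξ.toLinearMap) (continuous_norm.comp ξ.continuous)
  refine ⟨S, C, C.2, fun f => (h f).trans (mul_le_mul_of_nonneg_left ?_ C.2)⟩
  exact Seminorm.finset_sup_apply_le (Finset.sum_nonneg fun i _ => by positivity) fun i hi =>
    Finset.single_le_sum (f := fun i : ℕ × ℕ => SchwartzMap.seminorm ℂ i.1 i.2 f)
      (fun i _ => by positivity) hi

theorem SchwartzMap.hasTemperateGrowth_cutoff (hsT : s.HasTemperateGrowth) (h : 𝓢(ℝ, ℝ)) (r : ℝ) :
    (fun x => h (r * s x)).HasTemperateGrowth :=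
  h.hasTemperateGrowth.comp ((Function.HasTemperateGrowth.const r).mul hsT)

/-- A smooth function on the line which is `1` on `[-1, 1]` and `0` off `(-2, 2)`. -/
noncomputable def lineBump : ContDiffBump (0 : ℝ) := ⟨1, 2, one_pos, one_lt_two⟩

theorem contDiff_lineBump : ContDiff ℝ ∞ lineBump := lineBump.contDiff

theorem lineBump_eq_one {t : ℝ} (ht : |t| ≤ 1) : lineBump t = 1 :=
  lineBump.one_of_mem_closedBall (by simpa [lineBump] using ht)

theorem lineBump_eq_zero {t : ℝ} (ht : 2 ≤ |t|) : lineBump t = 0 :=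
  lineBump.zero_of_le_dist (by simpa [lineBump] using ht)

/-- The Schwartz function `t ↦ t ^ k θ(t)`, with `θ` the bump function on the line. -/
noncomputable def powBump (k : ℕ) : 𝓢(ℝ, ℝ) :=
  (lineBump.hasCompactSupport.mul_left (f := fun t => t ^ k)).toSchwartzMap
    ((contDiff_id.pow k).mul contDiff_lineBump)

theorem powBump_apply (k : ℕ) (t : ℝ) : powBump k t = t ^ k * lineBump t := rfl

theorem SchwartzMap.tsupport_sub_cutoff_subset (hsc : Continuous s) (f u : 𝓢(E, ℂ)) (r : ℝ)
    (hu : ∀ x, u x = powBump 0 (r * s x) • f x) : tsupport (f - u) ⊆ {x | 1 ≤ |r * s x|} := by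
  refine closure_minimal (fun x hx => ?_) (isClosed_le continuous_const (by fun_prop))
  by_contra hlt
  refine hx ?_
  change f x - u x = 0
  rw [hu, powBump_apply, lineBump_eq_one (not_le.1 hlt).le]
  simp

variable [FiniteDimensional ℝ E]

/-- The cut-offs `θ(r |x|²) f`, with `r → 0`, have compact support and converge to `f`, so that it
is enough to test a tempered distribution on functions of compact support. -/
theorem TemperedDistribution.eq_zero_of_hasCompactSupport (ξ : 𝓢'(E, ℂ)) (f : 𝓢(E, ℂ))
    (h : ∀ u : 𝓢(E, ℂ), HasCompactSupport u → tsupport u ⊆ tsupport f → ξ u = 0) : ξ f = 0 := by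
  obtain ⟨S, C, hC, hξ⟩ := ξ.exists_norm_le_sum_seminorm
  set T := toEuclidean (E := E)
  set s : E → ℝ := fun x => ‖T x‖ ^ 2 with hs_def
  set L : E →L[ℝ] E →L[ℝ] ℝ :=
    2 • (innerSL ℝ).bilinearComp T.toContinuousLinearMap T.toContinuousLinearMap
  have hs : ∀ x, HasFDerivAt s (L x) x := fun x =>
    ((T.hasFDerivAt (x := x)).norm_sq).congr_fderiv (by ext y; simp [L])
  have hsT : s.HasTemperateGrowth :=
    Function.HasTemperateGrowth.comp (g := fun y => ‖y‖ ^ 2)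
      (Function.hasTemperateGrowth_norm_sq _) T.hasTemperateGrowth
  have hsc : Continuous s := by fun_prop
  set u : ℝ → 𝓢(E, ℂ) := fun r => SchwartzMap.smulLeftCLM ℂ (fun x => powBump 0 (r * s x)) f
  have hu : ∀ r x, u r x = powBump 0 (r * s x) • f x := fun r x =>
    SchwartzMap.smulLeftCLM_apply_apply (SchwartzMap.hasTemperateGrowth_cutoff hsT _ r) f x
  have hcpt : ∀ r, 0 < r → HasCompactSupport (u r) := by
    intro r hr
    refine HasCompactSupport.intro' (K := {x | r * s x ≤ 2}) ?_ ?_ ?_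
    · have : {x | r * s x ≤ 2} ⊆ T ⁻¹' Metric.closedBall 0 (2 / r + 1) := by
        intro x hx
        have h1 : ‖T x‖ ^ 2 ≤ 2 / r := by
          rw [le_div_iff₀ hr, mul_comm]; exact hx
        simp only [Set.mem_preimage, mem_closedBall_zero_iff]
        nlinarith [norm_nonneg (T x), sq_nonneg (‖T x‖ - 1)]
      refine IsCompact.of_isClosed_subset ?_ (isClosed_le (by fun_prop) continuous_const) this
      exact T.toHomeomorph.isCompact_preimage.2 (isCompact_closedBall _ _)
    · exact isClosed_le (by fun_prop) continuous_const
    · intro x hx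
      rw [hu, powBump_apply, lineBump_eq_zero ((not_le.1 hx).le.trans (le_abs_self _))]
      simp
  have hts : ∀ r, tsupport (u r) ⊆ tsupport f := fun r => by
    have : (u r : E → ℂ) = fun x => powBump 0 (r * s x) • f x := funext (hu r)
    rw [this]
    exact tsupport_smul_subset_right _ _
  have key : ∀ i : ℕ × ℕ, ∃ K, 0 ≤ K ∧ ∀ r, 0 < r → r ≤ 1 →
      SchwartzMap.seminorm ℂ i.1 i.2 (f - u r) ≤ K * r := by
    rintro ⟨k, j⟩
    obtain ⟨K, hK, hb⟩ := cutoff_bound hs (powBump 0) f (k + 2) j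
    set A : ℝ := SchwartzMap.seminorm ℝ (k + 2) j f + K * 2 ^ j
    have hA : 0 ≤ A := by positivity
    refine ⟨‖T.toContinuousLinearMap‖ ^ 2 * A, by positivity, fun r hr hr1 => ?_⟩
    refine SchwartzMap.seminorm_le_bound ℂ k j _ (by positivity) fun x => ?_
    -- where `f` differs from its cut-off one has `1 ≤ r * s x`, which yields the factor `r`
    by_cases hx : r * s x < 1
    · have hz : iteratedFDeriv ℝ j (f - u r : 𝓢(E, ℂ)) x = 0 := by
        by_contra hne
        have h1 := support_iteratedFDeriv_subset j hne
        have h2 := SchwartzMap.tsupport_sub_cutoff_subset hsc f (u r) r (hu r) h1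
        have h3 : 0 ≤ r * s x := by positivity
        rw [Set.mem_ofPred_eq, abs_of_nonneg h3] at h2
        exact absurd hx (not_lt.2 h2)
      rw [hz, norm_zero, mul_zero]
      positivity
    · have h1 : ‖iteratedFDeriv ℝ j (f - u r : 𝓢(E, ℂ)) x‖ ≤ ‖iteratedFDeriv ℝ j f x‖ +
          ‖iteratedFDeriv ℝ j (fun x => powBump 0 (r * s x) • f x) x‖ := by
        have e : ((f - u r : 𝓢(E, ℂ)) : E → ℂ) = f - u r := rfl
        rw [e, iteratedFDeriv_sub_apply (f.smooth j).contDiffAt ((u r).smooth j).contDiffAt]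
        have e2 : (u r : E → ℂ) = fun x => powBump 0 (r * s x) • f x := funext (hu r)
        rw [e2]
        exact norm_sub_le _ _
      have h2 : s x ≤ ‖T.toContinuousLinearMap‖ ^ 2 * ‖x‖ ^ 2 := by
        rw [← mul_pow]
        exact pow_le_pow_left₀ (norm_nonneg _) (T.toContinuousLinearMap.le_opNorm x) 2
      have h3 : ‖x‖ ^ (k + 2) * ‖iteratedFDeriv ℝ j (f - u r : 𝓢(E, ℂ)) x‖ ≤ A := by
        refine (mul_le_mul_of_nonneg_left h1 (by positivity)).trans ?_
        rw [mul_add]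
        refine add_le_add (SchwartzMap.le_seminorm ℝ (k + 2) j f x) ((hb r hr.le x).trans ?_)
        gcongr
        linarith
      calc ‖x‖ ^ k * ‖iteratedFDeriv ℝ j (f - u r : 𝓢(E, ℂ)) x‖
          ≤ (r * s x) * (‖x‖ ^ k * ‖iteratedFDeriv ℝ j (f - u r : 𝓢(E, ℂ)) x‖) :=
            le_mul_of_one_le_left (by positivity) (not_lt.1 hx)
        _ ≤ (r * (‖T.toContinuousLinearMap‖ ^ 2 * ‖x‖ ^ 2)) *
            (‖x‖ ^ k * ‖iteratedFDeriv ℝ j (f - u r : 𝓢(E, ℂ)) x‖) := by gcongr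
        _ = r * ‖T.toContinuousLinearMap‖ ^ 2 *
            (‖x‖ ^ (k + 2) * ‖iteratedFDeriv ℝ j (f - u r : 𝓢(E, ℂ)) x‖) := by ring
        _ ≤ r * ‖T.toContinuousLinearMap‖ ^ 2 * A := by gcongr
        _ = _ := by ring
  choose K hK hb using key
  refine norm_le_zero_iff.1 (le_of_forall_pos_le_add fun ε hε => ?_)
  set B := C * ∑ i ∈ S, K i
  have hB : 0 ≤ B := mul_nonneg hC (Finset.sum_nonneg fun i _ => hK i)
  set r := min 1 (ε / (B + 1))
  have hr : 0 < r := lt_min one_pos (by positivity)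
  have h1 : ‖ξ f‖ ≤ B * r := by
    have e : ξ f = ξ (f - u r) := by rw [map_sub, h (u r) (hcpt r hr) (hts r), sub_zero]
    rw [e]
    refine (hξ _).trans ?_
    rw [mul_assoc, Finset.sum_mul]
    gcongr with i
    exact hb i r hr (min_le_left _ _)
  have h2 : B * r ≤ ε := by
    have : r ≤ ε / (B + 1) := min_le_right _ _
    rw [le_div_iff₀ (by positivity)] at this
    nlinarith
  linarith

open scoped Manifold in
/-- A tempered distribution vanishes on the complement of its support, also on functions whose
support is not compact. -/
theorem TemperedDistribution.isVanishingOn_compl_dsupport (ξ : 𝓢'(E, ℂ)) :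
    Distribution.IsVanishingOn ξ (Distribution.dsupport ξ)ᶜ := by
  intro f hf
  refine ξ.eq_zero_of_hasCompactSupport f fun u huc hu => ?_
  replace hu := hu.trans hf
  have hloc : ∀ x : ((Distribution.dsupport ξ)ᶜ : Set E), ∃ U, Distribution.IsVanishingOn ξ U ∧
      IsOpen U ∧ x.1 ∈ U := fun x => (Distribution.notMem_dsupport_iff x.1).1 x.2
  choose U hU hUo hxU using hloc
  obtain ⟨ρ, hρ⟩ := SmoothPartitionOfUnity.exists_isSubordinate 𝓘(ℝ, E) (isClosed_tsupport u) U hUo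
    (fun x hx => Set.mem_iUnion.2 ⟨⟨x, hu hx⟩, hxU _⟩)
  have hfin := ρ.locallyFinite.finite_nonempty_inter_compact huc.isCompact
  have hsm : ∀ i, ContDiff ℝ ∞ fun x => ρ i x • u x := fun i =>
    ((ρ i).contMDiff.contDiff).smul (u.smooth ⊤)
  set w : ((Distribution.dsupport ξ)ᶜ : Set E) → 𝓢(E, ℂ) := fun i =>
    (huc.smul_left (f := ρ i)).toSchwartzMap (hsm i)
  have hw : ∀ i x, w i x = ρ i x • u x := fun i x => rfl
  have hsum : u = ∑ i ∈ hfin.toFinset, w i := by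
    ext x
    rw [sum_apply]
    simp only [hw, ← Finset.sum_smul]
    by_cases hx : x ∈ tsupport u
    · have h1 := ρ.sum_eq_one hx
      rw [finsum_eq_sum_of_support_subset (s := hfin.toFinset)] at h1
      · rw [h1, one_smul]
      · intro i hi
        exact hfin.mem_toFinset.2 ⟨x, hi, hx⟩
    · rw [image_eq_zero_of_notMem_tsupport hx, smul_zero]
  rw [hsum, map_sum]
  exact Finset.sum_eq_zero fun i _ => hU i _ ((tsupport_smul_subset_left _ _).trans (hρ i))

/-- A tempered distribution supported in the zero set of a quadratic function `s` is killed by a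
power of `s`: near that set one may replace `s ^ k f` by `r ^ (-k) (r s) ^ k θ(r s) f`, whose
seminorms of order at most `J` are `O(r ^ (J - k))` as `r → ∞`. -/
theorem TemperedDistribution.exists_pow_smul_eq_zero (ξ : 𝓢'(E, ℂ))
    (hs : ∀ x, HasFDerivAt s (L x) x) (hsT : s.HasTemperateGrowth)
    (hsupp : ∀ x ∈ Distribution.dsupport ξ, s x = 0) :
    ∃ k : ℕ, ∀ f g : 𝓢(E, ℂ), (∀ x, g x = s x ^ k • f x) → ξ g = 0 := by
  obtain ⟨S, C, hC, hξ⟩ := ξ.exists_norm_le_sum_seminorm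
  have hsc : Continuous s := (contDiff_of_hasFDerivAt_clm hs).continuous
  set J := S.sup Prod.snd
  -- `J` bounds the order of `ξ`
  refine ⟨J + 1, fun f g hg => ?_⟩
  have key : ∀ i : ℕ × ℕ, ∃ K, 0 ≤ K ∧ ∀ r, 0 ≤ r → ∀ w : 𝓢(E, ℂ),
      (∀ x, w x = powBump (J + 1) (r * s x) • f x) →
      SchwartzMap.seminorm ℂ i.1 i.2 w ≤ K * (1 + r) ^ i.2 := by
    rintro ⟨k, j⟩
    obtain ⟨K, hK, hb⟩ := cutoff_bound hs (powBump (J + 1)) f k j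
    refine ⟨K, hK, fun r hr w hw => ?_⟩
    refine SchwartzMap.seminorm_le_bound ℂ k j _ (by positivity) fun x => ?_
    rw [show (w : E → ℂ) = _ from funext hw]
    exact hb r hr x
  choose K hK hb using key
  set B := C * ∑ i ∈ S, K i
  have hB : 0 ≤ B := mul_nonneg hC (Finset.sum_nonneg fun i _ => hK i)
  have main : ∀ r : ℝ, 1 ≤ r → r * ‖ξ g‖ ≤ B * 2 ^ J := by
    intro r hr
    set w : 𝓢(E, ℂ) := SchwartzMap.smulLeftCLM ℂ (fun x => powBump (J + 1) (r * s x)) f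
    have hw : ∀ x, w x = powBump (J + 1) (r * s x) • f x := fun x =>
      SchwartzMap.smulLeftCLM_apply_apply (SchwartzMap.hasTemperateGrowth_cutoff hsT _ r) f x
    set v : 𝓢(E, ℂ) := SchwartzMap.smulLeftCLM ℂ (fun x => powBump 0 (r * s x)) g
    have hv : ∀ x, v x = powBump 0 (r * s x) • g x := fun x =>
      SchwartzMap.smulLeftCLM_apply_apply (SchwartzMap.hasTemperateGrowth_cutoff hsT _ r) g x
    have hwv : w = ((r : ℂ) ^ (J + 1)) • v := by
      ext x
      rw [smul_apply, hw, hv, hg]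
      simp only [powBump_apply, Complex.real_smul, smul_eq_mul]
      push_cast
      ring
    have hgv : ξ g = ξ v := by
      rw [← sub_eq_zero, ← map_sub]
      refine ξ.isVanishingOn_compl_dsupport _ fun x hx hx' => ?_
      have := SchwartzMap.tsupport_sub_cutoff_subset hsc g v r hv hx
      rw [Set.mem_ofPred_eq, hsupp x hx', mul_zero, abs_zero] at this
      exact absurd this (by norm_num)
    have h1 : r ^ (J + 1) * ‖ξ g‖ ≤ B * (1 + r) ^ J := by
      have e : ‖ξ w‖ = r ^ (J + 1) * ‖ξ g‖ := by
        rw [hwv, map_smul, hgv, norm_smul, norm_pow, Complex.norm_real,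
          Real.norm_of_nonneg (by positivity)]
      rw [← e]
      refine (hξ w).trans ?_
      rw [mul_assoc, Finset.sum_mul]
      gcongr with i hi
      refine (hb i r (by positivity) w hw).trans ?_
      have := hK i
      gcongr
      · linarith
      · exact Finset.le_sup (f := Prod.snd) hi
    have h2 : (1 + r) ^ J ≤ 2 ^ J * r ^ J := by
      rw [← mul_pow]
      gcongr
      linarith
    have hrJ : 0 < r ^ J := by positivity
    refine le_of_mul_le_mul_left ?_ hrJ
    calc r ^ J * (r * ‖ξ g‖) = r ^ (J + 1) * ‖ξ g‖ := by ring
      _ ≤ B * (2 ^ J * r ^ J) := h1.trans (by gcongr)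
      _ = _ := by ring
  by_contra hne
  have hpos : 0 < ‖ξ g‖ := norm_pos_iff.2 hne
  have := main (B * 2 ^ J / ‖ξ g‖ + 1) (le_add_of_nonneg_left (by positivity))
  rw [add_mul, div_mul_cancel₀ _ hpos.ne', one_mul] at this
  linarith

end Cutoff

/-! ### One-parameter groups acting on Schwartz functions -/

section Flow

universe u

variable {E : Type u} {H : Type*} [NormedAddCommGroup E] [NormedSpace ℝ E]
  [NormedAddCommGroup H] [NormedSpace ℝ H]

/-- The derivative at `τ = 0` of `x ↦ c τ (f (g τ x))`, for one-parameter groups `g`, `c` with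
generators `D`, `C`. -/
noncomputable def flowGen (D : E →L[ℝ] E) (C : H →L[ℝ] H) (f : 𝓢(E, H)) : 𝓢(E, H) :=
  SchwartzMap.postcompCLM C f +
    SchwartzMap.bilinLeftCLM (ContinuousLinearMap.id ℝ (E →L[ℝ] H)) D.hasTemperateGrowth
      (SchwartzMap.fderivCLM ℝ E H f)

theorem flowGen_apply (D : E →L[ℝ] E) (C : H →L[ℝ] H) (f : 𝓢(E, H)) (x : E) :
    flowGen D C f x = C (f x) + fderiv ℝ f x (D x) := by
  simp [flowGen, SchwartzMap.bilinLeftCLM_apply]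

/-- `g` is a one-parameter group of operators with generator `D`. The group law itself is not needed
and is replaced by the differential equation `g' = g D` and by `g D = D g`. -/
structure IsFlow (g : ℝ → H →L[ℝ] H) (D : H →L[ℝ] H) : Prop where
  hasDerivAt : ∀ τ, HasDerivAt g (g τ ∘L D) τ
  map_zero : g 0 = ContinuousLinearMap.id ℝ H
  comm : ∀ τ, g τ ∘L D = D ∘L g τ

theorem isFlow_const : IsFlow (fun _ => ContinuousLinearMap.id ℝ H) 0 :=
  ⟨fun τ => by simpa using hasDerivAt_const τ _, rfl, fun τ => by simp⟩

theorem IsFlow.exists_bound {g : ℝ → H →L[ℝ] H} {D : H →L[ℝ] H} (hg : IsFlow g D) :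
    ∃ K, 0 ≤ K ∧ ∀ τ ∈ Set.Icc (0 : ℝ) 1, ‖g τ‖ ≤ K := by
  have hc : Continuous g := continuous_iff_continuousAt.2 fun τ => (hg.hasDerivAt τ).continuousAt
  obtain ⟨K, hK⟩ := isCompact_Icc.exists_bound_of_continuousOn
    (s := Set.Icc (0 : ℝ) 1) hc.continuousOn
  exact ⟨K, (norm_nonneg _).trans (hK 0 (by simp)), hK⟩

/-- The action of a pair of one-parameter groups on operators `E → H`. -/
noncomputable def homFlow (g : ℝ → E →L[ℝ] E) (c : ℝ → H →L[ℝ] H) (τ : ℝ) :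
    (E →L[ℝ] H) →L[ℝ] (E →L[ℝ] H) :=
  (ContinuousLinearMap.compL ℝ E H H (c τ)) ∘L ((ContinuousLinearMap.compL ℝ E E H).flip (g τ))

/-- The generator of `homFlow`. -/
noncomputable def homGen (D : E →L[ℝ] E) (C : H →L[ℝ] H) : (E →L[ℝ] H) →L[ℝ] (E →L[ℝ] H) :=
  ContinuousLinearMap.compL ℝ E H H C + (ContinuousLinearMap.compL ℝ E E H).flip D

theorem homGen_apply (D : E →L[ℝ] E) (C : H →L[ℝ] H) (A : E →L[ℝ] H) :
    homGen D C A = C ∘L A + A ∘L D := rfl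

theorem HasDerivAt.clm_comp_clm {A B X : Type*} [NormedAddCommGroup A] [NormedSpace ℝ A]
    [NormedAddCommGroup B] [NormedSpace ℝ B] [NormedAddCommGroup X] [NormedSpace ℝ X]
    (P : A →L[ℝ] X →L[ℝ] X) (Q : B →L[ℝ] X →L[ℝ] X) {u : ℝ → A} {u' : A} {v : ℝ → B} {v' : B}
    {τ : ℝ} (hu : HasDerivAt u u' τ) (hv : HasDerivAt v v' τ) {R : X →L[ℝ] X}
    (hR : P u' ∘L Q (v τ) + P (u τ) ∘L Q v' = R) :
    HasDerivAt (fun τ => P (u τ) ∘L Q (v τ)) R τ :=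
  hR ▸ (P.hasFDerivAt.comp_hasDerivAt τ hu).clm_comp (Q.hasFDerivAt.comp_hasDerivAt τ hv)

theorem IsFlow.hom {g : ℝ → E →L[ℝ] E} {D : E →L[ℝ] E} {c : ℝ → H →L[ℝ] H} {C : H →L[ℝ] H}
    (hg : IsFlow g D) (hc : IsFlow c C) : IsFlow (homFlow g c) (homGen D C) := by
  refine ⟨fun τ => ?_, ?_, fun τ => ?_⟩
  · refine HasDerivAt.clm_comp_clm (ContinuousLinearMap.compL ℝ E H H)
      (ContinuousLinearMap.compL ℝ E E H).flip (hc.hasDerivAt τ) (hg.hasDerivAt τ) ?_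
    rw [hg.comm]
    refine ContinuousLinearMap.ext fun A => ContinuousLinearMap.ext fun x => ?_
    change c τ (C (A (g τ x))) + c τ (A (D (g τ x))) = c τ (C (A (g τ x)) + A (D (g τ x)))
    rw [map_add]
  · refine ContinuousLinearMap.ext fun A => ContinuousLinearMap.ext fun x => ?_
    change c 0 (A (g 0 x)) = A x
    rw [hg.map_zero, hc.map_zero]
    rfl
  · refine ContinuousLinearMap.ext fun A => ContinuousLinearMap.ext fun x => ?_
    have h1 : g τ (D x) = D (g τ x) := DFunLike.congr_fun (hg.comm τ) x
    have h2 : c τ (C (A (g τ x))) = C (c τ (A (g τ x))) :=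
      DFunLike.congr_fun (hc.comm τ) (A (g τ x))
    change c τ (C (A (g τ x)) + A (D (g τ x))) = C (c τ (A (g τ x))) + c τ (A (g τ (D x)))
    rw [map_add, h1, h2]

variable {g : ℝ → E →L[ℝ] E} {D : E →L[ℝ] E}

theorem hasDerivAt_flow (hg : IsFlow g D) {c : ℝ → H →L[ℝ] H} {C : H →L[ℝ] H} (hc : IsFlow c C)
    (f : 𝓢(E, H)) (x : E) (τ : ℝ) :
    HasDerivAt (fun τ => c τ (f (g τ x))) (c τ (flowGen D C f (g τ x))) τ := by
  have h1 : HasDerivAt (fun τ => g τ x) ((g τ ∘L D) x) τ := (hg.hasDerivAt τ).clm_apply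
    (hasDerivAt_const τ x) |>.congr_deriv (by simp)
  have h2 : HasDerivAt (fun τ => f (g τ x)) (fderiv ℝ f (g τ x) ((g τ ∘L D) x)) τ :=
    (f.hasFDerivAt (g τ x)).comp_hasDerivAt τ h1
  refine ((hc.hasDerivAt τ).clm_apply h2).congr_deriv ?_
  rw [flowGen_apply, hg.comm, map_add]
  rfl

/-- Taylor expansion of first order of `τ ↦ c τ (f (g τ x))`, uniformly in `x`: the second
derivative is a Schwartz function evaluated at `g τ x`, up to the bounded operators `c τ`. -/
theorem flow_bound_zero (hg : IsFlow g D) {K : ℝ}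
    (hK : ∀ τ ∈ Set.Icc (0 : ℝ) 1, ∀ x, ‖x‖ ≤ K * ‖g τ x‖)
    {c : ℝ → H →L[ℝ] H} {C : H →L[ℝ] H} (hc : IsFlow c C) (f : 𝓢(E, H)) (k : ℕ) :
    ∃ B, 0 ≤ B ∧ ∀ τ ∈ Set.Icc (0 : ℝ) 1, ∀ x,
      ‖x‖ ^ k * ‖iteratedFDeriv ℝ 0 (fun x => c τ (f (g τ x)) - f x - τ • flowGen D C f x) x‖ ≤
        B * τ ^ 2 := by
  obtain ⟨K', hK'0, hK'⟩ := hc.exists_bound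
  set f₂ := flowGen D C (flowGen D C f) with hf₂
  set B := K' * (|K| ^ k * SchwartzMap.seminorm ℝ k 0 f₂)
  have hB : 0 ≤ B := by positivity
  refine ⟨B, hB, fun τ hτ x => ?_⟩
  have hbd : ∀ t ∈ Set.Icc (0 : ℝ) 1, ‖x‖ ^ k * ‖c t (f₂ (g t x))‖ ≤ B := by
    intro t ht
    calc ‖x‖ ^ k * ‖c t (f₂ (g t x))‖ ≤ (|K| * ‖g t x‖) ^ k * (K' * ‖f₂ (g t x)‖) := by
          gcongr
          · exact (hK t ht x).trans
              (mul_le_mul_of_nonneg_right (le_abs_self K) (norm_nonneg _))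
          · exact (c t).le_of_opNorm_le (hK' t ht) _
      _ = K' * (|K| ^ k * (‖g t x‖ ^ k * ‖f₂ (g t x)‖)) := by ring
      _ ≤ B := by
          exact mul_le_mul_of_nonneg_left (mul_le_mul_of_nonneg_left
            (SchwartzMap.norm_pow_mul_le_seminorm ℝ f₂ k _) (by positivity)) hK'0
  have hsub : ∀ t ∈ Set.Icc (0 : ℝ) τ, t ∈ Set.Icc (0 : ℝ) 1 := fun t ht => ⟨ht.1, ht.2.trans hτ.2⟩
  rw [norm_iteratedFDeriv_zero]
  have hw : ‖x‖ ^ k = ‖(‖x‖ ^ k : ℝ)‖ := by simp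
  -- two applications of the mean value inequality along the orbit of `x`
  have h1 : ∀ t ∈ Set.Icc (0 : ℝ) τ,
      ‖(‖x‖ ^ k : ℝ) • (c t (flowGen D C f (g t x)) - flowGen D C f x)‖ ≤ B * τ := by
    intro t ht
    have h := (convex_Icc (0 : ℝ) τ).norm_image_sub_le_of_norm_hasDerivWithin_le (C := B)
      (f := fun t => (‖x‖ ^ k : ℝ) • c t (flowGen D C f (g t x)))
      (fun t _ => ((hasDerivAt_flow hg hc (flowGen D C f) x t).const_smul
        (‖x‖ ^ k : ℝ)).hasDerivWithinAt)
      (fun t ht => by rw [norm_smul, ← hw]; exact hbd t (hsub t ht))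
      (Set.left_mem_Icc.2 hτ.1) ht
    simp only [hg.map_zero, hc.map_zero, ContinuousLinearMap.id_apply, sub_zero] at h
    rw [smul_sub]
    refine h.trans ?_
    rw [Real.norm_of_nonneg ht.1]
    gcongr
    exact ht.2
  have h2 := (convex_Icc (0 : ℝ) τ).norm_image_sub_le_of_norm_hasDerivWithin_le (C := B * τ)
      (f := fun t => (‖x‖ ^ k : ℝ) • (c t (f (g t x)) - t • flowGen D C f x))
      (fun t _ => (((hasDerivAt_flow hg hc f x t).sub
        ((hasDerivAt_id t).smul_const (flowGen D C f x))).const_smul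
          (‖x‖ ^ k : ℝ)).hasDerivWithinAt)
      (fun t ht => by rw [one_smul]; exact h1 t ht)
      (Set.left_mem_Icc.2 hτ.1) (Set.right_mem_Icc.2 hτ.1)
  simp only [hg.map_zero, hc.map_zero, ContinuousLinearMap.id_apply, sub_zero, zero_smul] at h2
  rw [← smul_sub, norm_smul, ← hw, Real.norm_of_nonneg hτ.1, sub_right_comm] at h2
  refine h2.trans_eq ?_
  ring

/-- The derivative in `x` of the Taylor remainder is the Taylor remainder of the derivative, for the
induced one-parameter group on `E →L[ℝ] H`. -/
theorem fderiv_flow {c : ℝ → H →L[ℝ] H} {C : H →L[ℝ] H}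
    (f : 𝓢(E, H)) (τ : ℝ) :
    fderiv ℝ (fun x => c τ (f (g τ x)) - f x - τ • flowGen D C f x) =
      fun x => homFlow g c τ (SchwartzMap.fderivCLM ℝ E H f (g τ x)) -
        SchwartzMap.fderivCLM ℝ E H f x -
        τ • flowGen D (homGen D C) (SchwartzMap.fderivCLM ℝ E H f) x := by
  funext x
  have h1 : HasFDerivAt (fun x => c τ (f (g τ x))) (c τ ∘L fderiv ℝ f (g τ x) ∘L g τ) x :=
    (c τ).hasFDerivAt.comp x ((f.hasFDerivAt (g τ x)).comp x (g τ).hasFDerivAt)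
  have h2 : HasFDerivAt (flowGen D C f)
      (flowGen D (homGen D C) (SchwartzMap.fderivCLM ℝ E H f) x) x := by
    have e : (flowGen D C f : E → H) = fun x => C (f x) + SchwartzMap.fderivCLM ℝ E H f x (D x) :=
      funext fun x => flowGen_apply D C f x
    rw [e]
    refine ((C.hasFDerivAt.comp x (f.hasFDerivAt x)).add
      (((SchwartzMap.fderivCLM ℝ E H f).hasFDerivAt x).clm_apply D.hasFDerivAt)).congr_fderiv ?_
    rw [flowGen_apply, homGen_apply]
    have hsymm : IsSymmSndFDerivAt ℝ f x :=
      (f.smooth 2).contDiffAt.isSymmSndFDerivAt (by simp)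
    ext y
    have := hsymm (D x) y
    have e2 : (SchwartzMap.fderivCLM ℝ E H f : E → E →L[ℝ] H) = fderiv ℝ f := rfl
    simp only [add_apply, ContinuousLinearMap.comp_apply, e2, ContinuousLinearMap.flip_apply, this]
    abel
  exact ((h1.sub (f.hasFDerivAt x)).sub (h2.const_smul τ)).fderiv

theorem flow_bound_succ (hg : IsFlow g D) (j : ℕ)
    (ih : ∀ (c : ℝ → (E →L[ℝ] H) →L[ℝ] (E →L[ℝ] H)) (C : (E →L[ℝ] H) →L[ℝ] (E →L[ℝ] H)),
      IsFlow c C → ∀ (f : 𝓢(E, E →L[ℝ] H)) (k : ℕ), ∃ B, 0 ≤ B ∧ ∀ τ ∈ Set.Icc (0 : ℝ) 1, ∀ x,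
        ‖x‖ ^ k * ‖iteratedFDeriv ℝ j (fun x => c τ (f (g τ x)) - f x - τ • flowGen D C f x) x‖ ≤
          B * τ ^ 2)
    {c : ℝ → H →L[ℝ] H} {C : H →L[ℝ] H} (hc : IsFlow c C) (f : 𝓢(E, H)) (k : ℕ) :
    ∃ B, 0 ≤ B ∧ ∀ τ ∈ Set.Icc (0 : ℝ) 1, ∀ x,
      ‖x‖ ^ k * ‖iteratedFDeriv ℝ (j + 1)
        (fun x => c τ (f (g τ x)) - f x - τ • flowGen D C f x) x‖ ≤ B * τ ^ 2 := by
  obtain ⟨B, hB, h⟩ := ih _ _ (hg.hom hc) (SchwartzMap.fderivCLM ℝ E H f) k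
  refine ⟨B, hB, fun τ hτ x => ?_⟩
  rw [← norm_iteratedFDeriv_fderiv, fderiv_flow]
  exact h τ hτ x

theorem flow_bound_aux (hg : IsFlow g D) {K : ℝ}
    (hK : ∀ τ ∈ Set.Icc (0 : ℝ) 1, ∀ x, ‖x‖ ≤ K * ‖g τ x‖) (j : ℕ) :
    ∀ (H : Type u) [NormedAddCommGroup H] [NormedSpace ℝ H] (c : ℝ → H →L[ℝ] H) (C : H →L[ℝ] H),
      IsFlow c C → ∀ (f : 𝓢(E, H)) (k : ℕ), ∃ B, 0 ≤ B ∧ ∀ τ ∈ Set.Icc (0 : ℝ) 1, ∀ x,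
        ‖x‖ ^ k * ‖iteratedFDeriv ℝ j (fun x => c τ (f (g τ x)) - f x - τ • flowGen D C f x) x‖ ≤
          B * τ ^ 2 := by
  induction j with
  | zero => intro H _ _ c C hc f k; exact flow_bound_zero hg hK hc f k
  | succ j ih => intro H _ _ c C hc f k; exact flow_bound_succ hg j (ih _) hc f k

/-- In every Schwartz seminorm, `f ∘ g τ = f + τ • flowGen D 0 f + O(τ ^ 2)`. -/
theorem flow_bound (hg : IsFlow g D) {K : ℝ}
    (hK : ∀ τ ∈ Set.Icc (0 : ℝ) 1, ∀ x, ‖x‖ ≤ K * ‖g τ x‖) (f : 𝓢(E, ℂ)) (k j : ℕ) :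
    ∃ B, 0 ≤ B ∧ ∀ τ ∈ Set.Icc (0 : ℝ) 1, ∀ x,
      ‖x‖ ^ k * ‖iteratedFDeriv ℝ j (fun x => f (g τ x) - f x - τ • flowGen D 0 f x) x‖ ≤
        B * τ ^ 2 := by
  cases j with
  | zero => exact flow_bound_zero hg hK isFlow_const f k
  | succ j => exact flow_bound_succ hg j (flow_bound_aux hg hK j _) isFlow_const f k

/-- A tempered distribution invariant under a one-parameter group is killed by its generator. -/
theorem TemperedDistribution.apply_flowGen_eq_zero (ξ : 𝓢'(E, ℂ)) (hg : IsFlow g D) {K : ℝ}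
    (hK : ∀ τ ∈ Set.Icc (0 : ℝ) 1, ∀ x, ‖x‖ ≤ K * ‖g τ x‖) (f : 𝓢(E, ℂ))
    (hξ : ∀ τ : ℝ, ∃ u : 𝓢(E, ℂ), (∀ x, u x = f (g τ x)) ∧ ξ u = ξ f) : ξ (flowGen D 0 f) = 0 := by
  obtain ⟨S, C, hC, hb⟩ := ξ.exists_norm_le_sum_seminorm
  choose B hB hbd using fun i : ℕ × ℕ => flow_bound hg hK f i.1 i.2
  set A := C * ∑ i ∈ S, B i
  have main : ∀ τ : ℝ, 0 < τ → τ ≤ 1 → ‖ξ (flowGen D 0 f)‖ ≤ A * τ := by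
    intro τ h0 h1
    obtain ⟨u, hu, huf⟩ := hξ τ
    have e : ξ (u - f - (τ : ℂ) • flowGen D 0 f) = -((τ : ℂ) * ξ (flowGen D 0 f)) := by
      rw [map_sub, map_sub, huf, sub_self, zero_sub, map_smul, smul_eq_mul]
    have h2 := hb (u - f - (τ : ℂ) • flowGen D 0 f)
    rw [e, norm_neg, norm_mul, Complex.norm_real, Real.norm_of_nonneg h0.le] at h2
    refine le_of_mul_le_mul_left (h2.trans ?_) h0
    rw [show τ * (A * τ) = C * ((∑ i ∈ S, B i) * τ ^ 2) by ring, Finset.sum_mul]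
    gcongr with i
    refine SchwartzMap.seminorm_le_bound ℂ i.1 i.2 _ (mul_nonneg (hB i) (by positivity)) fun x => ?_
    have e2 : ((u - f - (τ : ℂ) • flowGen D 0 f : 𝓢(E, ℂ)) : E → ℂ) =
        fun x => f (g τ x) - f x - τ • flowGen D 0 f x := by
      funext x
      simp [hu]
    rw [e2]
    exact hbd i τ ⟨h0.le, h1⟩ x
  have hA : 0 ≤ A := mul_nonneg hC (Finset.sum_nonneg fun i _ => hB i)
  refine norm_le_zero_iff.1 (le_of_forall_pos_le_add fun ε hε => ?_)
  refine (main (min 1 (ε / (A + 1))) (lt_min one_pos (by positivity)) (min_le_left _ _)).trans ?_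
  have h3 : min 1 (ε / (A + 1)) ≤ ε / (A + 1) := min_le_right _ _
  rw [le_div_iff₀ (by positivity)] at h3
  have h4 : 0 < min 1 (ε / (A + 1)) := lt_min one_pos (by positivity)
  nlinarith

end Flow

/-! ### Fourier inversion for the partial Fourier transform -/

namespace PartialFT

universe u

variable {E W : Type u} [NormedAddCommGroup E] [NormedSpace ℝ E]
  [NormedAddCommGroup W] [NormedSpace ℝ W] [FiniteDimensional ℝ W]
  [MeasurableSpace W] [BorelSpace W]
  (μ : Measure W) [μ.IsAddHaarMeasure] (L : W →L[ℝ] W →L[ℝ] ℝ)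

/-- In linear coordinates an integral against a Haar measure is a multiple of the Lebesgue
integral. -/
theorem exists_integral_eq_smul {V : Type*} [NormedAddCommGroup V] [InnerProductSpace ℝ V]
    [FiniteDimensional ℝ V] [MeasurableSpace V] [BorelSpace V] (Φ : V ≃L[ℝ] W) :
    ∃ c : ℝ, c ≠ 0 ∧ ∀ f : W → ℂ, ∫ w, f w ∂μ = c • ∫ x, f (Φ x) := by
  have := Φ.isAddHaarMeasure_map (volume : Measure V)
  have h := Measure.isAddLeftInvariant_eq_smul μ ((volume : Measure V).map Φ)
  refine ⟨(Measure.addHaarScalarFactor μ ((volume : Measure V).map Φ) : ℝ), ?_, fun f => ?_⟩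
  · exact NNReal.coe_ne_zero.2 (Measure.addHaarScalarFactor_pos_of_isAddHaarMeasure μ
      ((volume : Measure V).map Φ)).ne'
  · conv_lhs => rw [h]
    rw [integral_smul_nnreal_measure]
    congr 1
    exact Φ.toHomeomorph.measurableEmbedding.integral_map f

/-- Fourier inversion, for a nondegenerate symmetric form `L` and an arbitrary Haar measure, up to a
nonzero constant. -/
theorem exists_pft_pft_eq (hL : ∀ w, ∃ v, ‖v‖ ≤ 1 ∧ ‖w‖ ≤ |L v w|) (hsymm : ∀ v w, L v w = L w v) :
    ∃ c : ℂ, c ≠ 0 ∧ ∀ (f : 𝓢(E × W, ℂ)) (a : E) (z : W),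
      pft μ L (pft μ L f) (a, z) = c * f (a, -z) := by
  set V := EuclideanSpace ℝ (Fin (Module.finrank ℝ W))
  set Φ : V ≃L[ℝ] W := toEuclidean.symm
  -- `T` represents the form `L` by the inner product: `L (Φ x) y = ⟪x, T y⟫`
  set T₀ : W →ₗ[ℝ] V :=
    ((InnerProductSpace.toDual ℝ V).symm.toLinearEquiv.toLinearMap).comp
      (L.bilinearComp Φ.toContinuousLinearMap (ContinuousLinearMap.id ℝ W)).flip.toLinearMap
  have hT₀ : ∀ x y, L (Φ x) y = inner ℝ x (T₀ y) := by
    intro x y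
    rw [real_inner_comm]
    exact (InnerProductSpace.toDual_symm_apply (𝕜 := ℝ) (E := V) (x := x)
      (y := (L.bilinearComp Φ.toContinuousLinearMap (ContinuousLinearMap.id ℝ W)).flip y)).symm
  have hinj : Function.Injective T₀ := by
    refine (injective_iff_map_eq_zero T₀).2 fun y hy => ?_
    obtain ⟨v, -, hv⟩ := hL y
    have := hT₀ (Φ.symm v) y
    rw [hy, inner_zero_right, Φ.apply_symm_apply] at this
    rwa [this, abs_zero, norm_le_zero_iff] at hv
  set T : W ≃L[ℝ] V :=
    (LinearEquiv.ofInjectiveOfFinrankEq T₀ hinj (by simp [V])).toContinuousLinearEquiv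
  have hT : ∀ x y, L (Φ x) y = inner ℝ x (T y) := hT₀
  obtain ⟨c, hc, hcΦ⟩ := exists_integral_eq_smul μ Φ
  obtain ⟨d, hd, hdT⟩ := exists_integral_eq_smul μ T.symm
  refine ⟨c * d, mul_ne_zero (Complex.ofReal_ne_zero.2 hc) (Complex.ofReal_ne_zero.2 hd),
    fun f a z => ?_⟩
  set G : 𝓢(V, ℂ) := SchwartzMap.compCLMOfContinuousLinearEquiv ℂ Φ (slice a f)
  have hG : ∀ x, G x = f (a, Φ x) := fun x => rfl
  have h1 : ∀ y, pft μ L f (a, y) = c • 𝓕 G (T y) := by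
    intro y
    rw [pft_def, hcΦ, SchwartzMap.fourier_coe, Real.fourier_eq]
    congr 2
    funext x
    rw [hT]
    rfl
  have h2 : pft μ L (pft μ L f) (a, z) = d • c • 𝓕 (𝓕 G) (Φ.symm z) := by
    rw [pft_def, hdT, SchwartzMap.fourier_coe, Real.fourier_eq]
    congr 1
    rw [← integral_smul]
    congr 1
    funext t
    rw [h1, T.apply_symm_apply, smul_comm c]
    have : L (T.symm t) z = inner ℝ t (Φ.symm z) := by
      rw [hsymm]
      have := hT (Φ.symm z) (T.symm t)
      rwa [Φ.apply_symm_apply, T.apply_symm_apply, real_inner_comm] at this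
    rw [this]
    rfl
  have h3 : 𝓕 (𝓕 G) (Φ.symm z) = G (-(Φ.symm z)) := by
    have h4 : 𝓕⁻ (𝓕 G) = G := FourierTransform.fourierInv_fourier_eq G
    have h5 := DFunLike.congr_fun h4 (-(Φ.symm z))
    rw [SchwartzMap.fourierInv_apply_eq] at h5
    rw [← h5]
    change _ = 𝓕 (𝓕 G) (- -(Φ.symm z))
    rw [neg_neg]
  rw [h2, h3, hG, map_neg, Φ.apply_symm_apply]
  simp only [Complex.real_smul]
  ring

end PartialFT

theorem partialFourierSchwartz_surjective (n : ℕ) (F : Type*) [RCLike F] :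
    Function.Surjective (partialFourierSchwartz n F) := by
  intro g
  obtain ⟨c, hc, h⟩ := PartialFT.exists_pft_pft_eq (E := Sl n F) volume (negRePairing n F)
    (negRePairing_nondeg n F) (fun v w => by
      rw [negRePairing_apply, negRePairing_apply, pairing, pairing, add_comm])
  set N : XSpace n F ≃L[ℝ] XSpace n F :=
    (ContinuousLinearEquiv.refl ℝ (Sl n F)).prodCongr (ContinuousLinearEquiv.neg ℝ)
  set u := SchwartzMap.compCLMOfContinuousLinearEquiv ℂ N g
  refine ⟨c⁻¹ • partialFourierSchwartz n F u, ?_⟩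
  ext ⟨a, z⟩
  rw [map_smul, smul_apply, partialFourierSchwartz_apply, partialFourierFun_eq_pft]
  have e : (partialFourierSchwartz n F u : XSpace n F → ℂ) =
      PartialFT.pft volume (negRePairing n F) u :=
    partialFourierFun_eq_pft _
  rw [e, h, smul_eq_mul, inv_mul_cancel_left₀ hc]
  change g (a, - -z) = _
  rw [neg_neg]

open LineDeriv in
/-- The partial Fourier transform turns multiplication by the linear function `Re B(·, d)` into the
derivative in the direction `d`. -/
theorem lineDeriv_partialFourierSchwartz {n : ℕ} {F : Type*} [RCLike F] (d : VVdual n F)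
    (f g : 𝓢(XSpace n F, ℂ))
    (hg : ∀ x, g x = (2 * Real.pi * Complex.I * (RCLike.re (pairing x.2 d) : ℝ)) * f x) :
    ∂_{((0 : Sl n F), d)} (partialFourierSchwartz n F f) = partialFourierSchwartz n F g := by
  ext p
  rw [SchwartzMap.lineDerivOp_apply_eq_fderiv]
  have e : ∀ f : 𝓢(XSpace n F, ℂ), (partialFourierSchwartz n F f : XSpace n F → ℂ) =
      PartialFT.pft volume (negRePairing n F) f := fun f => partialFourierFun_eq_pft _
  rw [e, e, (PartialFT.hasFDerivAt_pft _ _ f p).fderiv, PartialFT.pft_def, PartialFT.pft_def]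
  refine (ContinuousLinearMap.integral_apply (PartialFT.integrable_slice _ _ _ _) _).trans ?_
  congr 1
  funext v
  simp only [smul_apply, PartialFT.dpft_apply, hg, negRePairing_apply]
  have h0 : fderiv ℝ f (p.1, v) ((0 : Sl n F), (0 : VVdual n F)) = 0 := map_zero _
  rw [h0, zero_add]
  simp only [smul_eq_mul, Complex.real_smul]
  push_cast
  ring

/-! ### The Weyl algebra acting on Schwartz functions -/

section Operators

universe u

variable {E : Type u} [NormedAddCommGroup E] [NormedSpace ℝ E]

/-- Multiplication by a real linear functional. -/
noncomputable def mulOp (l : E →L[ℝ] ℝ) : Module.End ℂ 𝓢(E, ℂ) :=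
  (SchwartzMap.smulLeftCLM ℂ (fun x => (l x : ℂ))).toLinearMap

/-- The derivative in the direction of a vector. -/
noncomputable def derivOp (e : E) : Module.End ℂ 𝓢(E, ℂ) :=
  (LineDeriv.lineDerivOpCLM ℂ 𝓢(E, ℂ) e).toLinearMap

theorem mulOp_apply (l : E →L[ℝ] ℝ) (f : 𝓢(E, ℂ)) (x : E) : mulOp l f x = l x * f x :=
  SchwartzMap.smulLeftCLM_apply_apply
    (Function.HasTemperateGrowth.comp Function.Complex.hasTemperateGrowth_ofReal
      l.hasTemperateGrowth) f x

theorem derivOp_apply (e : E) (f : 𝓢(E, ℂ)) (x : E) : derivOp e f x = fderiv ℝ f x e := rfl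

theorem mulOp_commute (l m : E →L[ℝ] ℝ) : Commute (mulOp l) (mulOp m) :=
  LinearMap.ext fun f => SchwartzMap.ext fun x => by
    simp only [Module.End.mul_apply, mulOp_apply]
    ring

theorem derivOp_commute (e e' : E) : Commute (derivOp e) (derivOp e') := by
  refine LinearMap.ext fun f => SchwartzMap.ext fun x => ?_
  have h : ∀ v w : E, fderiv ℝ (derivOp w f) x v = fderiv ℝ (fderiv ℝ f) x v w := by
    intro v w
    have h1 : HasFDerivAt (fderiv ℝ f) (fderiv ℝ (fderiv ℝ f) x) x :=
      (SchwartzMap.fderivCLM ℝ E ℂ f).hasFDerivAt x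
    have h2 := h1.clm_apply (hasFDerivAt_const w x)
    rw [show (derivOp w f : E → ℂ) = fun x => fderiv ℝ f x w from rfl, h2.fderiv]
    simp
  have hsymm : IsSymmSndFDerivAt ℝ f x :=
    (f.smooth 2).contDiffAt.isSymmSndFDerivAt (by simp)
  simp only [Module.End.mul_apply, derivOp_apply, h]
  exact hsymm e e'

theorem derivOp_mul_mulOp (e : E) (l : E →L[ℝ] ℝ) :
    derivOp e * mulOp l = mulOp l * derivOp e + (l e : ℂ) • 1 := by
  refine LinearMap.ext fun f => SchwartzMap.ext fun x => ?_
  have h : HasFDerivAt (mulOp l f) ((l x : ℂ) • fderiv ℝ f x +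
      (Complex.ofRealCLM ∘L l).smulRight (f x)) x := by
    rw [show (mulOp l f : E → ℂ) = fun x => (l x : ℂ) * f x from funext (mulOp_apply l f)]
    exact (Complex.ofRealCLM.hasFDerivAt.comp x l.hasFDerivAt).smul (f.hasFDerivAt x)
  simp only [Module.End.mul_apply, add_apply, LinearMap.add_apply, LinearMap.smul_apply,
    Module.End.one_apply, smul_apply, derivOp_apply, mulOp_apply, h.fderiv]
  simp

theorem derivOp_commute_mulOp {e : E} {l : E →L[ℝ] ℝ} (h : l e = 0) :
    Commute (derivOp e) (mulOp l) := by
  have := derivOp_mul_mulOp e l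
  rwa [h, Complex.ofReal_zero, zero_smul, add_zero] at this

theorem derivOp_mul_mulOp_of_eq_one {e : E} {l : E →L[ℝ] ℝ} (h : l e = 1) :
    derivOp e * mulOp l = mulOp l * derivOp e + 1 := by
  rw [derivOp_mul_mulOp, h, Complex.ofReal_one, one_smul]

theorem mulOp_mul_pow_apply (l m : E →L[ℝ] ℝ) (k : ℕ) (f : 𝓢(E, ℂ)) (x : E) :
    ((mulOp l * mulOp m) ^ k) f x = (l x * m x) ^ k • f x := by
  induction k with
  | zero => simp
  | succ k ih =>
    rw [pow_succ', Module.End.mul_apply, Module.End.mul_apply, mulOp_apply, mulOp_apply, ih]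
    simp only [Complex.real_smul]
    push_cast
    ring

theorem TemperedDistribution.exists_mulOp_pow_eq_zero [FiniteDimensional ℝ E] (ξ : 𝓢'(E, ℂ))
    (l m : E →L[ℝ] ℝ) (h : ∀ x ∈ Distribution.dsupport ξ, l x * m x = 0) :
    ∃ k : ℕ, ∀ f, ξ (((mulOp l * mulOp m) ^ k) f) = 0 := by
  obtain ⟨k, hk⟩ := ξ.exists_pow_smul_eq_zero (s := fun x => l x * m x)
    (L := l.smulRight m + m.smulRight l)
    (fun x => (l.hasFDerivAt.mul m.hasFDerivAt).congr_fderiv (by ext; simp))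
    (l.hasTemperateGrowth.mul m.hasTemperateGrowth) h
  exact ⟨k, fun f => hk f _ (mulOp_mul_pow_apply l m k f)⟩

theorem eulerOp_commute {l l' : E →L[ℝ] ℝ} {e e' : E} (h : l e' = 0) (h' : l' e = 0) :
    Commute (mulOp l * derivOp e) (mulOp l' * derivOp e') :=
  ((mulOp_commute l l').mul_right (derivOp_commute_mulOp h).symm).mul_left
    ((derivOp_commute_mulOp h').mul_right (derivOp_commute e e'))

/-- The form of `LinearMap.eq_zero_of_weyl` for a tempered distribution and two families of
coordinates `l i`, `m j` with dual vectors `e i`, `d j`. The coordinates need not form a full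
system on `E`. -/
theorem TemperedDistribution.eq_zero_of_coordinates {ι : Type*} [Fintype ι] [Nonempty ι]
    [DecidableEq ι] (ξ : 𝓢'(E, ℂ)) (l m : ι → E →L[ℝ] ℝ) (e d : ι → E)
    (hle : ∀ i j, l i (e j) = if j = i then 1 else 0)
    (hmd : ∀ i j, m i (d j) = if j = i then 1 else 0)
    (hld : ∀ i j, l i (d j) = 0) (hme : ∀ i j, m i (e j) = 0)
    (hmul : ∀ i j, ∃ k, ∀ f, ξ (((mulOp (l i) * mulOp (m j)) ^ k) f) = 0)
    (hder : ∀ i j, ∃ k, ∀ f, ξ (((derivOp (e i) * derivOp (d j)) ^ k) f) = 0)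
    (hinv : ∀ f, ξ ((∑ i, mulOp (l i) * derivOp (e i) - ∑ j, mulOp (m j) * derivOp (d j)) f) = 0) :
    ξ = 0 := by
  have h : (ξ.toLinearMap : 𝓢(E, ℂ) →ₗ[ℂ] ℂ) = 0 :=
    LinearMap.eq_zero_of_weyl ξ.toLinearMap (fun i => mulOp (l i)) (fun i => derivOp (e i))
      (fun j => mulOp (m j)) (fun j => derivOp (d j))
      (fun i => derivOp_mul_mulOp_of_eq_one (by rw [hle, if_pos rfl]))
      (fun i => derivOp_mul_mulOp_of_eq_one (by rw [hmd, if_pos rfl]))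
      (fun i j hij => eulerOp_commute (by rw [hle, if_neg hij.symm]) (by rw [hle, if_neg hij]))
      (fun i j hij => eulerOp_commute (by rw [hmd, if_neg hij.symm]) (by rw [hmd, if_neg hij]))
      (fun i j => mulOp_commute _ _) (fun i j => (derivOp_commute_mulOp (hld i j)).symm)
      (fun i j => derivOp_commute_mulOp (hme j i)) (fun i j => derivOp_commute _ _) hmul hder hinv
  ext f
  exact DFunLike.congr_fun h f

end Operators

/-! ### Distributions on `sl(V) × V × V*` -/

section XSpace

variable {n : ℕ} {F : Type*} [RCLike F]

/-- The real linear functional `(A, w) ↦ Re B(w, d)` on `X`. -/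
noncomputable def pairingFunctional (d : VVdual n F) : XSpace n F →L[ℝ] ℝ :=
  -((negRePairing n F).flip d ∘L ContinuousLinearMap.snd ℝ (Sl n F) (VVdual n F))

theorem pairingFunctional_apply (d : VVdual n F) (x : XSpace n F) :
    pairingFunctional d x = RCLike.re (pairing x.2 d) := by
  simp [pairingFunctional, negRePairing_apply]

theorem derivOp_partialFourierSchwartz (d : VVdual n F) (f : 𝓢(XSpace n F, ℂ)) :
    derivOp ((0 : Sl n F), d) (partialFourierSchwartz n F f) =
      partialFourierSchwartz n F ((2 * Real.pi * Complex.I) • mulOp (pairingFunctional d) f) := by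
  refine lineDeriv_partialFourierSchwartz d f _ fun x => ?_
  rw [smul_apply, mulOp_apply, pairingFunctional_apply, smul_eq_mul, ← mul_assoc]

theorem derivOp_pow_partialFourierSchwartz (d d' : VVdual n F) (k : ℕ) (f : 𝓢(XSpace n F, ℂ)) :
    ((derivOp ((0 : Sl n F), d) * derivOp ((0 : Sl n F), d')) ^ k) (partialFourierSchwartz n F f) =
      ((2 * Real.pi * Complex.I) ^ 2) ^ k • partialFourierSchwartz n F
        (((mulOp (pairingFunctional d) * mulOp (pairingFunctional d')) ^ k) f) := by
  induction k with
  | zero => simp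
  | succ k ih =>
    rw [pow_succ' (_ * _), Module.End.mul_apply, ih, map_smul, Module.End.mul_apply,
      derivOp_partialFourierSchwartz, derivOp_partialFourierSchwartz, pow_succ' (mulOp _ * _),
      Module.End.mul_apply, Module.End.mul_apply, map_smul, map_smul, map_smul, smul_smul,
      smul_smul]
    congr 1
    ring

/-- A support condition on the Fourier transform of `ξ` makes products of two derivatives nilpotent
on `ξ`. -/
theorem exists_derivOp_pow_eq_zero (ξ : 𝓢'(XSpace n F, ℂ)) (d d' : VVdual n F)
    (h : ∀ x ∈ Distribution.dsupport (partialFourier ξ),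
      pairingFunctional d x * pairingFunctional d' x = 0) :
    ∃ k : ℕ, ∀ f, ξ (((derivOp ((0 : Sl n F), d) * derivOp ((0 : Sl n F), d')) ^ k) f) = 0 := by
  obtain ⟨k, hk⟩ := (partialFourier ξ).exists_mulOp_pow_eq_zero _ _ h
  refine ⟨k, fun f => ?_⟩
  obtain ⟨f, rfl⟩ := partialFourierSchwartz_surjective n F f
  rw [derivOp_pow_partialFourierSchwartz, map_smul, ← partialFourier_apply, hk, smul_zero]

variable (n F) in
/-- The projection of `X` to `V`. -/
noncomputable def vecProj : XSpace n F →L[ℝ] (Fin n → F) :=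
  ContinuousLinearMap.fst ℝ _ _ ∘L ContinuousLinearMap.snd ℝ (Sl n F) (VVdual n F)

variable (n F) in
/-- The projection of `X` to `V*`. -/
noncomputable def covecProj : XSpace n F →L[ℝ] (Fin n → F) :=
  ContinuousLinearMap.snd ℝ _ _ ∘L ContinuousLinearMap.snd ℝ (Sl n F) (VVdual n F)

variable (n F) in
/-- The inclusion of `V` in `X`. -/
noncomputable def vecIncl : (Fin n → F) →L[ℝ] XSpace n F :=
  ContinuousLinearMap.inr ℝ (Sl n F) (VVdual n F) ∘L ContinuousLinearMap.inl ℝ _ _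

variable (n F) in
/-- The inclusion of `V*` in `X`. -/
noncomputable def covecIncl : (Fin n → F) →L[ℝ] XSpace n F :=
  ContinuousLinearMap.inr ℝ (Sl n F) (VVdual n F) ∘L ContinuousLinearMap.inr ℝ _ _

variable (n F) in
/-- The action `(A, v, φ) ↦ (A, exp(τ) v, exp(-τ) φ)` of the positive scalar matrices. -/
noncomputable def scalarFlow (τ : ℝ) : XSpace n F →L[ℝ] XSpace n F :=
  ContinuousLinearMap.inl ℝ _ _ ∘L ContinuousLinearMap.fst ℝ _ _ +
    Real.exp τ • (vecIncl n F ∘L vecProj n F) + Real.exp (-τ) • (covecIncl n F ∘L covecProj n F)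

variable (n F) in
/-- The generator of `scalarFlow`. -/
noncomputable def scalarGen : XSpace n F →L[ℝ] XSpace n F :=
  vecIncl n F ∘L vecProj n F - covecIncl n F ∘L covecProj n F

theorem scalarFlow_apply (τ : ℝ) (x : XSpace n F) :
    scalarFlow n F τ x = (x.1, Real.exp τ • x.2.1, Real.exp (-τ) • x.2.2) := by
  simp [scalarFlow, vecIncl, vecProj, covecIncl, covecProj]

theorem scalarGen_apply (x : XSpace n F) : scalarGen n F x = (0, x.2.1, -x.2.2) := by
  simp [scalarGen, vecIncl, vecProj, covecIncl, covecProj]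

theorem isFlow_scalarFlow : IsFlow (scalarFlow n F) (scalarGen n F) := by
  refine ⟨fun τ => ?_, ?_, fun τ => ?_⟩
  · have h1 := (Real.hasDerivAt_exp τ).smul_const (vecIncl n F ∘L vecProj n F)
    have h2 := ((Real.hasDerivAt_exp (-τ)).comp τ (hasDerivAt_neg τ)).smul_const
      (covecIncl n F ∘L covecProj n F)
    refine (((hasDerivAt_const τ _).add h1).add h2).congr_deriv ?_
    refine ContinuousLinearMap.ext fun x => ?_
    rw [ContinuousLinearMap.comp_apply, scalarFlow_apply, scalarGen_apply]
    simp [vecIncl, vecProj, covecIncl, covecProj]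
  · refine ContinuousLinearMap.ext fun x => ?_
    simp [scalarFlow_apply]
  · refine ContinuousLinearMap.ext fun x => ?_
    simp [scalarFlow_apply, scalarGen_apply]

/-- The flow does not contract too fast for times in `[0, 1]`. -/
theorem norm_le_scalarFlow (τ : ℝ) (hτ : τ ∈ Set.Icc (0 : ℝ) 1) (x : XSpace n F) :
    ‖x‖ ≤ Real.exp 1 * ‖scalarFlow n F τ x‖ := by
  have h1 : (1 : ℝ) ≤ Real.exp 1 := Real.one_le_exp zero_le_one
  have key : ∀ (V : Type _) [NormedAddCommGroup V] [NormedSpace ℝ V] (σ : ℝ) (v : V), -1 ≤ σ →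
      ‖v‖ ≤ Real.exp 1 * ‖Real.exp σ • v‖ := by
    intro V _ _ σ v hσ
    rw [norm_smul, Real.norm_of_nonneg (Real.exp_pos _).le, ← mul_assoc, ← Real.exp_add]
    exact le_mul_of_one_le_left (norm_nonneg _) (Real.one_le_exp (by linarith))
  rw [scalarFlow_apply, Prod.norm_def, Prod.norm_def]
  refine max_le ?_ (max_le ?_ ?_)
  · refine (le_mul_of_one_le_left (norm_nonneg _) h1).trans ?_
    gcongr
    exact le_max_left _ _
  · refine (key _ τ x.2.1 (by linarith [hτ.1])).trans ?_
    gcongr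
    exact (le_max_left _ _).trans (le_max_right _ _)
  · refine (key _ (-τ) x.2.2 (by linarith [hτ.2])).trans ?_
    gcongr
    exact (le_max_right _ _).trans (le_max_right _ _)

/-- The scalar matrix `c`. -/
def scalarGL (n : ℕ) {F : Type*} [RCLike F] (c : Fˣ) : GL (Fin n) F :=
  ⟨(c : F) • 1, ((c⁻¹ : Fˣ) : F) • 1, by simp [smul_smul], by simp [smul_smul]⟩

theorem gTildeEquiv_scalar (c : Fˣ) (x : XSpace n F) :
    gTildeEquiv (SemidirectProduct.inl (scalarGL n c)) x =
      (x.1, (c : F) • x.2.1, ((c⁻¹ : Fˣ) : F) • x.2.2) := by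
  have h : gTildeEquiv (SemidirectProduct.inl (scalarGL n c)) x = glAct n F (scalarGL n c) x := by
    rw [← gTildeAct_inl]
    rfl
  rw [h]
  refine Prod.ext (Subtype.ext ?_) (Prod.ext ?_ ?_)
  · change ((c : F) • (1 : Matrix (Fin n) (Fin n) F)) * x.1.val * (((c⁻¹ : Fˣ) : F) • 1) = x.1.val
    simp [smul_smul]
  · change ((c : F) • (1 : Matrix (Fin n) (Fin n) F)).mulVec x.2.1 = _
    rw [Matrix.smul_mulVec, Matrix.one_mulVec]
  · change Matrix.vecMul x.2.2 (((c⁻¹ : Fˣ) : F) • (1 : Matrix (Fin n) (Fin n) F)) = _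
    rw [Matrix.vecMul_smul, Matrix.vecMul_one]

theorem IsChiEquivariant.apply_flowGen_eq_zero {ξ : 𝓢'(XSpace n F, ℂ)} (hξ : IsChiEquivariant ξ)
    (f : 𝓢(XSpace n F, ℂ)) : ξ (flowGen (scalarGen n F) 0 f) = 0 := by
  refine ξ.apply_flowGen_eq_zero isFlow_scalarFlow norm_le_scalarFlow f fun τ => ?_
  set c : Fˣ := Units.mk0 ((Real.exp τ : ℝ) : F) (RCLike.ofReal_ne_zero.2 (Real.exp_ne_zero τ))
  have h := hξ (SemidirectProduct.inl (scalarGL n c)) f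
  rw [chi_inl, Units.val_one, one_mul] at h
  refine ⟨_, fun x => ?_, h⟩
  change f (gTildeEquiv _ x) = _
  rw [gTildeEquiv_scalar, scalarFlow_apply, Units.val_inv_eq_inv_val, Units.val_mk0, Real.exp_neg,
    ← RCLike.ofReal_inv, RCLike.real_smul_eq_coe_smul (K := F),
    RCLike.real_smul_eq_coe_smul (K := F)]

/-- For `n = 0` the group `GL(V)` gives no information, and the involution acts trivially on the
one-point space `X`, while `χ(σ) = -1`. -/
theorem IsChiEquivariant.eq_zero_of_dim_zero {ξ : 𝓢'(XSpace 0 F, ℂ)} (hξ : IsChiEquivariant ξ) :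
    ξ = 0 := by
  ext f
  have h := hξ (SemidirectProduct.inr (-1)) f
  have e : SchwartzMap.compCLMOfContinuousLinearEquiv ℂ
      (gTildeEquiv (SemidirectProduct.inr (-1))) f = f := by
    ext x
    have : Subsingleton (Sl 0 F) := ⟨fun A B => Subtype.ext (Subsingleton.elim _ _)⟩
    exact congrArg f (Subsingleton.elim _ _)
  rw [e, chi_sigma] at h
  have h2 : ξ f = -ξ f := by simpa using h
  exact CharZero.eq_neg_self_iff.1 h2

/-- In real coordinates the generator is the difference of the Euler fields of `V` and `V*`. -/
theorem flowGen_scalarGen_eq_sum {ι : Type*} [Fintype ι] (b : Module.Basis ι ℝ (Fin n → F))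
    (f : 𝓢(XSpace n F, ℂ)) :
    (∑ i, mulOp ((b.coord i).toContinuousLinearMap ∘L vecProj n F) * derivOp (vecIncl n F (b i)) -
      ∑ j, mulOp ((b.coord j).toContinuousLinearMap ∘L covecProj n F) *
        derivOp (covecIncl n F (b j))) f = flowGen (scalarGen n F) 0 f := by
  ext x
  have hb : ∀ v : Fin n → F, ∑ i, b.coord i v • b i = v := b.sum_repr
  have e : scalarGen n F x = ∑ i, b.coord i (vecProj n F x) • vecIncl n F (b i) -
      ∑ j, b.coord j (covecProj n F x) • covecIncl n F (b j) := by
    simp only [← map_smul, ← map_sum, hb]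
    rfl
  rw [flowGen_apply, e, map_sub, map_sum, map_sum]
  simp only [LinearMap.sub_apply, LinearMap.sum_apply, sub_apply, sum_apply, Module.End.mul_apply,
    mulOp_apply, derivOp_apply, map_smul, Complex.real_smul, zero_apply, zero_add]
  rfl

end XSpace

theorem mainTheorem6 {F : Type*} [RCLike F] (n : ℕ) (ξ : 𝓢'(XSpace n F, ℂ))
    (hξ : IsChiEquivariant ξ)
    (hsupp : Distribution.dsupport ξ ⊆ slTimesCross n F)
    (hsuppF : Distribution.dsupport (partialFourier ξ) ⊆ slTimesCross n F) :
    ξ = 0 := by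
  rcases Nat.eq_zero_or_pos n with rfl | hn
  · exact hξ.eq_zero_of_dim_zero
  have : NeZero n := ⟨hn.ne'⟩
  set b := Module.finBasis ℝ (Fin n → F)
  have : Nonempty (Fin (Module.finrank ℝ (Fin n → F))) := b.index_nonempty
  have hcross : ∀ x ∈ slTimesCross n F, x.2.2 = 0 ∨ x.2.1 = 0 := by
    rintro x ⟨-, hx | hx⟩
    · exact Or.inl hx.2
    · exact Or.inr hx.1
  have hbb : ∀ i j, b.coord i (b j) = if j = i then 1 else 0 := fun i j => by
    rw [b.coord_apply, b.repr_self, Finsupp.single_apply]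
  set l : Fin (Module.finrank ℝ (Fin n → F)) → XSpace n F →L[ℝ] ℝ :=
    fun i => (b.coord i).toContinuousLinearMap ∘L vecProj n F
  set m : Fin (Module.finrank ℝ (Fin n → F)) → XSpace n F →L[ℝ] ℝ :=
    fun i => (b.coord i).toContinuousLinearMap ∘L covecProj n F
  have hl : ∀ i x, l i x = b.coord i x.2.1 := fun i x => rfl
  have hm : ∀ i x, m i x = b.coord i x.2.2 := fun i x => rfl
  have hll : ∀ i j, l i (vecIncl n F (b j)) = if j = i then 1 else 0 := hbb
  have hmm : ∀ i j, m i (covecIncl n F (b j)) = if j = i then 1 else 0 := hbb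
  have hlm : ∀ i j, l i (covecIncl n F (b j)) = 0 := fun i j => map_zero (b.coord i)
  have hml : ∀ i j, m i (vecIncl n F (b j)) = 0 := fun i j => map_zero (b.coord i)
  refine ξ.eq_zero_of_coordinates l m _ _ hll hmm hlm hml (fun i j => ?_) (fun i j => ?_)
    (fun f => ?_)
  · refine ξ.exists_mulOp_pow_eq_zero (l i) (m j) fun x hx => ?_
    rcases hcross x (hsupp hx) with h | h
    · rw [hm, h, map_zero, mul_zero]
    · rw [hl, h, map_zero, zero_mul]
  · refine exists_derivOp_pow_eq_zero ξ (b i, 0) (0, b j) fun x hx => ?_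
    rw [pairingFunctional_apply, pairingFunctional_apply]
    rcases hcross x (hsuppF hx) with h | h <;> simp [pairing, h]
  · rw [flowGen_scalarGen_eq_sum b f]
    exact hξ.apply_flowGen_eq_zero f
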